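/- **Theorem.** Let $\lambda$ be a shape, i.e. a finite induced subgraph of the square grid $\mathbb{Z}\times\mathbb{Z}$. A vertex of $\lambda$ is *interior* if all nine vertices of the $2\times 2$ grid centered at it lie in $\lambda$, and a *boundary vertex* otherwise. A *path* supported by $\lambda$ is a sequence $v_0,\dots,v_t$ of vertices, each one step South or East of the previous one, with $v_0,v_t$ boundary vertices and $v_1,\dots,v_{t-1}$ interior. A *segment* is a nonempty such sequence of South/East steps all of whose vertices are interior (a single vertex is allowed); $S$ denotes the set of segments of $\lambda$, ordered by inclusion ($s\le t$ if $s$ is a contiguous subsequence of $t$), and $S^*$ its dual poset (reverse inclusion). Two paths $p,q$ *kiss along* a common subpath $s$ from $v$ to $v'$ if one of them, say $p$, enters $v$ from the West and leaves $v'$ to the South, while $q$ enters $v$ from the North and leaves $v'$ to the East. Consider the simplicial complex whose faces are the sets of pairwise non-kissing paths supported by $\lambda$ that are neither horizontal nor vertical. For facets (maximal faces) $F,F'$ write $F\xrightarrow{s}F'$ if $F\setminus F'=\{p\}$, $F'\setminus F=\{q\}$, and $p,q$ kiss along the segment $s$ with $p$ entering $s$ from the West and leaving it to the South. Let $\mathrm{GT}(\lambda)$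 be the set of facets with the reflexive transitive closure of the relation "$F\xrightarrow{s}F'$ for some $s$". Then $\mathrm{GT}(\lambda)$ is a lattice. Let $\mathrm{Con}(\mathrm{GT}(\lambda))$ be the lattice of its lattice congruences ordered by refinement, let $J(\mathrm{Con}(\mathrm{GT}(\lambda)))$ be the subposet of join-irreducible congruences (the least congruence not being counted as join-irreducible), and let $\mathrm{con}(F,F')$ be the smallest congruence with $F\equiv F'$. Then: 1. There is an isomorphism of posets $\Phi: S^*\to J(\mathrm{Con}(\mathrm{GT}(\lambda)))$ such that $\Phi(s)=\mathrm{con}(F,F')$ whenever $F\xrightarrow{s}F'$. 2. $\mathrm{Con}(\mathrm{GT}(\lambda))$ is isomorphic, as a lattice, to the lattice $\mathcal{O}(S^*)$ of order ideals of $S^*$, ordered by inclusion. -/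

import Mathlib

/-- The south and east unit steps of the square grid `ℤ × ℤ`. The first coordinate increases to
the east, the second one increases to the north. -/
def GridStep (v w : ℤ × ℤ) : Prop :=
  w = (v.1, v.2 - 1) ∨ w = (v.1 + 1, v.2)

/-- A shape is a finite induced subgraph of the square grid, i.e. a finite set of vertices.
A vertex is interior if the shape contains the `2 × 2` grid (nine vertices) centered at it. -/
def IsInterior (shape : Finset (ℤ × ℤ)) (v : ℤ × ℤ) : Prop :=
  ∀ i ∈ Finset.Icc (-1 : ℤ) 1, ∀ j ∈ Finset.Icc (-1 : ℤ) 1, (v.1 + i, v.2 + j) ∈ shape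

/-- A boundary vertex is a vertex of the shape that is not interior. -/
def IsBoundary (shape : Finset (ℤ × ℤ)) (v : ℤ × ℤ) : Prop :=
  v ∈ shape ∧ ¬ IsInterior shape v

/-- A path `v₀, …, vₜ` supported by the shape: each vertex is one step south or east of the
previous one, `v₀` and `vₜ` are boundary vertices, and `v₁, …, vₜ₋₁` are interior vertices. -/
structure IsGridPath (shape : Finset (ℤ × ℤ)) (p : List (ℤ × ℤ)) : Prop where
  ne_nil : p ≠ []
  steps : p.IsChain GridStep
  head_boundary : ∀ v ∈ p.head?, IsBoundary shape v
  last_boundary : ∀ v ∈ p.getLast?, IsBoundary shape v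
  inner_interior : ∀ v ∈ p.tail.dropLast, IsInterior shape v

/-- A path is horizontal if all its vertices lie on one horizontal line. -/
def IsHorizontal (p : List (ℤ × ℤ)) : Prop := ∀ v ∈ p, ∀ w ∈ p, v.2 = w.2

/-- A path is vertical if all its vertices lie on one vertical line. -/
def IsVertical (p : List (ℤ × ℤ)) : Prop := ∀ v ∈ p, ∀ w ∈ p, v.1 = w.1

/-- A segment of the shape: a nonempty sequence of interior vertices, each one step south or east
of the previous one. One-vertex (lazy) segments are allowed. -/
@[ext]
structure Segment (shape : Finset (ℤ × ℤ)) where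
  verts : List (ℤ × ℤ)
  ne_nil : verts ≠ []
  steps : verts.IsChain GridStep
  interior : ∀ v ∈ verts, IsInterior shape v

/-- Segments are ordered by inclusion: `s ≤ t` if `s` is a subsegment of `t`, i.e. a contiguous
subsequence. -/
instance Segment.instPartialOrder (shape : Finset (ℤ × ℤ)) : PartialOrder (Segment shape) where
  le s t := s.verts <:+: t.verts
  le_refl s := List.infix_refl s.verts
  le_trans _ _ _ hst htu := List.IsInfix.trans hst htu
  le_antisymm _ _ hst hts :=
    Segment.ext (hst.eq_of_length (le_antisymm hst.length_le hts.length_le))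

/-- `KissAlong p q s`: both `p` and `q` contain `s`, from its first vertex `v` to its last vertex
`v'`; `p` enters `v` from the west and leaves `v'` to the south, whereas `q` enters `v` from the
north and leaves `v'` to the east. (The case `v = v'` is allowed.) -/
def KissAlong (p q s : List (ℤ × ℤ)) : Prop :=
  ∃ v v' : ℤ × ℤ, s.head? = some v ∧ s.getLast? = some v' ∧
    ((v.1 - 1, v.2) :: (s ++ [(v'.1, v'.2 - 1)])) <:+: p ∧
    ((v.1, v.2 + 1) :: (s ++ [(v'.1 + 1, v'.2)])) <:+: q

/-- Two paths are kissing if they kiss along some common subpath, in one of the two roles. -/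
def Kissing (p q : List (ℤ × ℤ)) : Prop :=
  ∃ s, KissAlong p q s ∨ KissAlong q p s

/-- A face of the reduced non-kissing complex: a set of pairwise non-kissing paths supported by the
shape, none of which is horizontal or vertical. -/
def IsNonKissingFace (shape : Finset (ℤ × ℤ)) (F : Set (List (ℤ × ℤ))) : Prop :=
  (∀ p ∈ F, IsGridPath shape p ∧ ¬ IsHorizontal p ∧ ¬ IsVertical p) ∧
    F.Pairwise fun p q => ¬ Kissing p q

/-- The facets (maximal faces) of the reduced non-kissing complex. They are the elements of the
Grid-Tamari order. -/
def GridTamari (shape : Finset (ℤ × ℤ)) : Type :=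
  {F : Set (List (ℤ × ℤ)) // Maximal (IsNonKissingFace shape) F}

/-- `GridTamari.Flip s F G`: the facets `F` and `G` are adjacent, i.e. they are obtained from each
other by exchanging a single path `p` of `F` with a single path `q` of `G`; `p` and `q` kiss along
the segment `s`, and `p` enters `s` from the west (and leaves it to the south). This is the oriented
edge `F → G` of the dual graph, with label `s`. -/
def GridTamari.Flip {shape : Finset (ℤ × ℤ)} (s : Segment shape) (F G : GridTamari shape) : Prop :=
  ∃ p q, F.1 \ G.1 = {p} ∧ G.1 \ F.1 = {q} ∧ KissAlong p q s.verts

/-- The Grid-Tamari relation: the reflexive transitive closure of the oriented dual graph. -/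
def GridTamari.Reach {shape : Finset (ℤ × ℤ)} (F G : GridTamari shape) : Prop :=
  Relation.ReflTransGen (fun A B : GridTamari shape => ∃ s, GridTamari.Flip s A B) F G

/-- Lattice congruences are ordered by refinement. -/
instance LatticeCon.instPartialOrder {α : Type*} [Lattice α] : PartialOrder (LatticeCon α) where
  le c d := ∀ ⦃x y : α⦄, c.r x y → d.r x y
  le_refl _ _ _ h := h
  le_trans _ _ _ hcd hde _ _ h := hde (hcd h)
  le_antisymm c d hcd hdc := by
    obtain ⟨c₀, _, _⟩ := c
    obtain ⟨d₀, _, _⟩ := d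
    have : c₀ = d₀ := Setoid.ext fun x y => ⟨fun h => hcd h, fun h => hdc h⟩
    subst this
    rfl

/-- The intersection of a family of lattice congruences. -/
instance LatticeCon.instInfSet {α : Type*} [Lattice α] : InfSet (LatticeCon α) where
  sInf C :=
    { r := fun x y => ∀ c ∈ C, c.r x y
      iseqv :=
        ⟨fun x c _ => c.refl x, fun h c hc => c.symm (h c hc),
          fun h h' c hc => c.trans (h c hc) (h' c hc)⟩
      inf := fun h h' c hc => c.inf (h c hc) (h' c hc)
      sup := fun h h' c hc => c.sup (h c hc) (h' c hc) }

/-- The lattice congruences of a lattice form a complete lattice under refinement. -/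
instance LatticeCon.instCompleteLattice {α : Type*} [Lattice α] : CompleteLattice (LatticeCon α) :=
  completeLatticeOfInf (LatticeCon α) fun _ =>
    ⟨fun _ hc _ _ h => h _ hc, fun _ hb _ _ h _ hc => hb hc h⟩

/-- `LatticeCon.con x y` is the smallest lattice congruence that identifies `x` and `y`. -/
def LatticeCon.con {α : Type*} [Lattice α] (x y : α) : LatticeCon α :=
  sInf {c | c.r x y}

/-!
# The Grid-Tamari order is a lattice whose congruences are governed by segment inclusion

A set of segments is called a torsion set if it is closed under composition and under quotient
pieces, i.e. contiguous subsegments which the ambient segment enters from the north and leaves to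
the east wherever they are cut off. (Sub-pieces are entered from the west and left to the south.)
Torsion sets are closed under intersection, so they form a lattice; this lattice is isomorphic to
the Grid-Tamari order, and everything is read off from it.

*Facets and torsion sets.* To a torsion set `X` one attaches the set `pathSet X` of all bent paths
whose inner quotient pieces lie in `X` and whose inner sub-pieces do not; no two of them kiss. A
chain satisfying these constraints can always be prolonged by a step at either end
(`Valid.exists_succ`, `Valid.exists_pred`), so there are enough such paths for their quotient pieces
to generate `X` (`filt_quotOf_pathSet`) and for `pathSet X` to be a facet (`maximal_pathSet`).
Conversely, the quotient pieces of a facet generate a torsion set from which the facet is recovered.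
The result is `facetEquiv`.

*Flips and covers.* If `Y` covers `X`, exactly one member of `Y` has no sub-piece in `X`
(`exists_isLabel`); the facets of `X` and `Y` differ by one path under this label and one path over
it, so they form a flip (`IsLabel.flip`). Conversely a flip is a cover (`isLabel_of_flip`), because
no torsion set can exchange the same path along a cover above it and along a cover below it
(`IsLabel.not_under_and_over`). As the lattice is finite, inclusion of torsion sets is reachability
by flips.

*Congruences.* The join-irreducible torsion sets are the sets of quotient pieces of single segments,
so a congruence is determined by the set `U` of segments whose join-irreducible it contracts to its
lower cover, and it identifies `X` and `Y` precisely when they agree outside `U`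
(`Labelling.rel_iff`). The set `U` is closed under passing to longer segments, by means of the
torsion sets `TorsionSet.avoiding`; and any such `U` occurs, since restricting torsion sets to a
collection of segments closed under subsegments respects joins (`TorsionSet.mem_sup_of_restrict`).
Hence congruences correspond to the lower sets of the dual of the poset of segments, and the
join-irreducible ones to the principal lower sets.
-/

namespace NonKissing

/-! ### Walks and the lists of vertices they trace -/

/-- A bi-infinite walk with south and east steps, recorded by its horizontal coordinate as a
function of the diagonal index `d = x - y`, which every step raises by one. Restricting walks to
intervals of indices gives all finite walks, and two of them overlap exactly where the underlying
functions agree. -/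
structure Walk where
  /-- The horizontal coordinate on the diagonal `x - y = d`. -/
  toFun : ℤ → ℤ
  step : ∀ d, toFun (d + 1) = toFun d ∨ toFun (d + 1) = toFun d + 1

instance : CoeFun Walk fun _ => ℤ → ℤ := ⟨Walk.toFun⟩

/-- The vertex of the walk `f` on the diagonal `x - y = d`. -/
def vtx (f : Walk) (d : ℤ) : ℤ × ℤ := (f d, f d - d)

namespace Walk

/-- The walk `f` steps east from diagonal `d` to diagonal `d + 1`. -/
def East (f : Walk) (d : ℤ) : Prop := f (d + 1) = f d + 1

/-- The walk `f` steps south from diagonal `d` to diagonal `d + 1`. -/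
def South (f : Walk) (d : ℤ) : Prop := f (d + 1) = f d

/-- Two walks coincide on all diagonals between `i` and `j`. -/
def Agree (f g : Walk) (i j : ℤ) : Prop := ∀ d, i ≤ d → d ≤ j → f d = g d

theorem south_or_east (f : Walk) (d : ℤ) : f.South d ∨ f.East d := f.step d

theorem South.not_east {f : Walk} {d : ℤ} (h : f.South d) : ¬ f.East d := by
  unfold South East at *; omega

theorem East.not_south {f : Walk} {d : ℤ} (h : f.East d) : ¬ f.South d := by
  unfold South East at *; omega

theorem south_of_not_east {f : Walk} {d : ℤ} (h : ¬ f.East d) : f.South d :=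
  (f.south_or_east d).resolve_right h

theorem east_of_not_south {f : Walk} {d : ℤ} (h : ¬ f.South d) : f.East d :=
  (f.south_or_east d).resolve_left h

theorem Agree.refl (f : Walk) (i j : ℤ) : f.Agree f i j := fun _ _ _ => rfl

theorem Agree.symm {f g : Walk} {i j : ℤ} (h : f.Agree g i j) : g.Agree f i j :=
  fun d hi hj => (h d hi hj).symm

theorem Agree.trans {f g h : Walk} {i j : ℤ} (h₁ : f.Agree g i j) (h₂ : g.Agree h i j) :
    f.Agree h i j :=
  fun d hi hj => (h₁ d hi hj).trans (h₂ d hi hj)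

theorem Agree.mono {f g : Walk} {i j i' j' : ℤ} (h : f.Agree g i j) (hi : i ≤ i') (hj : j' ≤ j) :
    f.Agree g i' j' :=
  fun d h₁ h₂ => h d (hi.trans h₁) (h₂.trans hj)

theorem Agree.east {f g : Walk} {i j d : ℤ} (h : f.Agree g i j) (he : f.East d) (hi : i ≤ d)
    (hj : d < j) : g.East d := by
  have h₁ := h d hi hj.le
  have h₂ := h (d + 1) (by omega) (by omega)
  unfold East at *; omega

theorem Agree.south {f g : Walk} {i j d : ℤ} (h : f.Agree g i j) (he : f.South d) (hi : i ≤ d)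
    (hj : d < j) : g.South d := by
  have h₁ := h d hi hj.le
  have h₂ := h (d + 1) (by omega) (by omega)
  unfold South at *; omega

theorem Agree.vtx {f g : Walk} {i j d : ℤ} (h : f.Agree g i j) (hi : i ≤ d) (hj : d ≤ j) :
    vtx f d = vtx g d := by
  simp [NonKissing.vtx, h d hi hj]

/-- Replace the walk `f` after the index `j` by the vertical ray with horizontal coordinate `c`. -/
def spliceRight (f : Walk) (j c : ℤ) (hc : c = f j ∨ c = f j + 1) : Walk where
  toFun d := if d ≤ j then f d else c
  step d := by
    have := f.step d
    rcases lt_trichotomy d j with h | h | h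
    · simpa [show d ≤ j by omega, show d + 1 ≤ j by omega] using this
    · subst h; simpa using hc
    · simp [show ¬ d ≤ j by omega, show ¬ d + 1 ≤ j by omega]

/-- Replace the walk `f` before the index `i` by the vertical ray with horizontal coordinate `c`. -/
def spliceLeft (f : Walk) (i c : ℤ) (hc : f i = c ∨ f i = c + 1) : Walk where
  toFun d := if i ≤ d then f d else c
  step d := by
    have := f.step d
    rcases lt_trichotomy (d + 1) i with h | h | h
    · simp [show ¬ i ≤ d by omega, show ¬ i ≤ d + 1 by omega]
    · subst h; simpa using hc
    · simpa [show i ≤ d by omega, show i ≤ d + 1 by omega] using this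

theorem exists_south_right (f : Walk) (j : ℤ) :
    ∃ g : Walk, (∀ d ≤ j, f d = g d) ∧ g.South j :=
  ⟨f.spliceRight j (f j) (Or.inl rfl), fun d hd => by simp [spliceRight, hd],
    by simp [South, spliceRight]⟩

theorem exists_east_right (f : Walk) (j : ℤ) :
    ∃ g : Walk, (∀ d ≤ j, f d = g d) ∧ g.East j :=
  ⟨f.spliceRight j (f j + 1) (Or.inr rfl), fun d hd => by simp [spliceRight, hd],
    by simp [East, spliceRight]⟩

theorem exists_south_left (f : Walk) (i : ℤ) :
    ∃ g : Walk, (∀ d, i ≤ d → f d = g d) ∧ g.South (i - 1) :=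
  ⟨f.spliceLeft i (f i) (Or.inl rfl), fun d hd => by simp [spliceLeft, hd],
    by simp [South, spliceLeft]⟩

theorem exists_east_left (f : Walk) (i : ℤ) :
    ∃ g : Walk, (∀ d, i ≤ d → f d = g d) ∧ g.East (i - 1) :=
  ⟨f.spliceLeft i (f i - 1) (Or.inr (by ring)), fun d hd => by simp [spliceLeft, hd],
    by simp [East, spliceLeft]⟩

end Walk

/-- The list of vertices of the walk `f` on the diagonals `i, i + 1, …, j`. -/
def seg (f : Walk) (i j : ℤ) : List (ℤ × ℤ) :=
  (List.range (j + 1 - i).toNat).map fun k : ℕ => vtx f (i + k)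

theorem seg_eq_nil {f : Walk} {i j : ℤ} (h : j < i) : seg f i j = [] := by
  simp [seg, show (j + 1 - i).toNat = 0 by omega]

theorem seg_cons {f : Walk} {i j : ℤ} (h : i ≤ j) :
    seg f i j = vtx f i :: seg f (i + 1) j := by
  obtain ⟨n, hn⟩ : ∃ n : ℕ, (j + 1 - i).toNat = n + 1 := ⟨(j - i).toNat, by omega⟩
  have hn' : (j + 1 - (i + 1)).toNat = n := by omega
  simp only [seg, hn, hn', List.range_succ_eq_map, List.map_cons, List.map_map]
  congr 1
  · simp
  · refine List.map_congr_left fun k _ => ?_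
    simp only [Function.comp_apply, Nat.succ_eq_add_one]
    congr 1; push_cast; ring

theorem mem_seg {f : Walk} {i j : ℤ} {v : ℤ × ℤ} :
    v ∈ seg f i j ↔ ∃ d, i ≤ d ∧ d ≤ j ∧ v = vtx f d := by
  simp only [seg, List.mem_map, List.mem_range]
  constructor
  · rintro ⟨k, hk, rfl⟩
    exact ⟨i + k, by omega, by omega, rfl⟩
  · rintro ⟨d, h₁, h₂, rfl⟩
    exact ⟨(d - i).toNat, by omega, by congr 1; omega⟩

theorem length_seg (f : Walk) (i j : ℤ) : (seg f i j).length = (j + 1 - i).toNat := by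
  simp [seg]

theorem seg_ne_nil {f : Walk} {i j : ℤ} : seg f i j ≠ [] ↔ i ≤ j := by
  rw [← List.length_pos_iff, length_seg]; omega

theorem seg_append {f : Walk} {i m j : ℤ} (h₁ : i ≤ m + 1) (h₂ : m ≤ j) :
    seg f i j = seg f i m ++ seg f (m + 1) j := by
  obtain ⟨n, hn⟩ : ∃ n : ℕ, n = (m + 1 - i).toNat := ⟨_, rfl⟩
  induction n generalizing i with
  | zero =>
    obtain rfl : i = m + 1 := by omega
    simp [seg_eq_nil (show m < m + 1 by omega)]
  | succ n ih =>
    rw [seg_cons (show i ≤ j by omega), seg_cons (show i ≤ m by omega),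
      ih (by omega) (by omega), List.cons_append]

theorem seg_singleton (f : Walk) (i : ℤ) : seg f i i = [vtx f i] := by
  rw [seg_cons le_rfl, seg_eq_nil (by omega)]

theorem seg_snoc {f : Walk} {i j : ℤ} (h : i ≤ j) :
    seg f i j = seg f i (j - 1) ++ [vtx f j] := by
  rw [seg_append (m := j - 1) (by omega) (by omega), sub_add_cancel, seg_singleton]

theorem vtx_inj {f g : Walk} {d e : ℤ} (h : vtx f d = vtx g e) : d = e ∧ f d = g e := by
  simp only [vtx, Prod.mk.injEq] at h; omega

theorem Walk.Agree.seg {f g : Walk} {i j : ℤ} (h : f.Agree g i j) : seg f i j = seg g i j := by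
  refine List.map_congr_left fun k hk => ?_
  rw [List.mem_range] at hk
  exact h.vtx (by omega) (by omega)

theorem seg_inj {f g : Walk} {i j i' j' : ℤ} (hij : i ≤ j) (h : seg f i j = seg g i' j') :
    i = i' ∧ j = j' ∧ f.Agree g i j := by
  have hlen := congrArg List.length h
  rw [length_seg, length_seg] at hlen
  have hij' : i' ≤ j' := by omega
  have hi : i = i' := by
    rw [seg_cons hij, seg_cons hij'] at h
    exact (vtx_inj (List.cons_eq_cons.1 h).1).1
  subst hi
  obtain rfl : j = j' := by omega
  refine ⟨rfl, rfl, fun d h₁ h₂ => ?_⟩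
  obtain ⟨e, _, _, he⟩ :=
    mem_seg.1 (h ▸ mem_seg.2 ⟨d, h₁, h₂, rfl⟩ : vtx f d ∈ NonKissing.seg g i j)
  obtain ⟨rfl, h'⟩ := vtx_inj he
  exact h'

theorem head?_seg {f : Walk} {i j : ℤ} (h : i ≤ j) : (seg f i j).head? = some (vtx f i) := by
  simp [seg_cons h]

theorem getLast?_seg {f : Walk} {i j : ℤ} (h : i ≤ j) :
    (seg f i j).getLast? = some (vtx f j) := by
  simp [seg_snoc h]

theorem gridStep_vtx (f : Walk) (d : ℤ) : GridStep (vtx f d) (vtx f (d + 1)) := by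
  rcases f.step d with h | h
  · left; simp only [vtx, h, Prod.mk.injEq, true_and]; omega
  · right; simp only [vtx, h, Prod.mk.injEq, true_and]; omega

theorem isChain_seg (f : Walk) (i j : ℤ) : (seg f i j).IsChain GridStep := by
  obtain ⟨n, hn⟩ : ∃ n : ℕ, n = (j + 1 - i).toNat := ⟨_, rfl⟩
  induction n generalizing i with
  | zero => simp [seg_eq_nil (show j < i by omega)]
  | succ n ih =>
    rw [seg_cons (by omega)]
    refine List.isChain_cons.2 ⟨fun v hv => ?_, ih _ (by omega)⟩
    by_cases h : i + 1 ≤ j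
    · rw [head?_seg h] at hv
      obtain rfl : vtx f (i + 1) = v := by simpa using hv
      exact gridStep_vtx f i
    · simp [seg_eq_nil (show j < i + 1 by omega)] at hv

theorem exists_seg_of_isChain {l : List (ℤ × ℤ)} (hl : l ≠ []) (h : l.IsChain GridStep) :
    ∃ f i j, i ≤ j ∧ l = seg f i j := by
  induction l with
  | nil => exact absurd rfl hl
  | cons v l ih =>
    rcases eq_or_ne l [] with rfl | hne
    · refine ⟨⟨fun _ => v.1, fun _ => Or.inl rfl⟩, v.1 - v.2, v.1 - v.2, le_rfl, ?_⟩
      rw [seg_singleton]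
      simp [vtx]
    · obtain ⟨h₁, h₂⟩ := List.isChain_cons.1 h
      obtain ⟨f, i, j, hij, rfl⟩ := ih hne h₂
      have hs : GridStep v (vtx f i) := h₁ _ (by simp [head?_seg hij])
      have hc : f i = v.1 ∨ f i = v.1 + 1 := by
        rcases hs with hs | hs <;> simp only [vtx, Prod.mk.injEq] at hs <;> omega
      have hv : v.2 = v.1 - (i - 1) := by
        rcases hs with hs | hs <;> simp only [vtx, Prod.mk.injEq] at hs <;> omega
      refine ⟨f.spliceLeft i v.1 hc, i - 1, j, by omega, ?_⟩
      have ha : f.Agree (f.spliceLeft i v.1 hc) i j := fun d hd _ => by simp [Walk.spliceLeft, hd]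
      rw [seg_cons (show i - 1 ≤ j by omega), sub_add_cancel, ← ha.seg]
      congr 1
      simp [vtx, Walk.spliceLeft, Prod.ext_iff, hv]

theorem eq_seg_of_append {f : Walk} {i j : ℤ} {x y : List (ℤ × ℤ)} (hij : i ≤ j + 1)
    (h : x ++ y = seg f i j) :
    ∃ m, i ≤ m + 1 ∧ m ≤ j ∧ x = seg f i m ∧ y = seg f (m + 1) j := by
  induction x generalizing i with
  | nil => exact ⟨i - 1, by omega, by omega, by rw [seg_eq_nil (by omega)], by simpa using h⟩
  | cons v x ih =>
    have hij' : i ≤ j := by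
      by_contra hc
      simp [seg_eq_nil (show j < i by omega)] at h
    rw [seg_cons hij', List.cons_append, List.cons_eq_cons] at h
    obtain ⟨m, h₁, h₂, h₃, h₄⟩ := ih (by omega) h.2
    exact ⟨m, by omega, h₂, by rw [seg_cons (by omega), h.1, h₃], h₄⟩

theorem infix_seg_iff {f : Walk} {a b : ℤ} {l : List (ℤ × ℤ)} (hl : l ≠ []) :
    l <:+: seg f a b ↔ ∃ i j, a ≤ i ∧ i ≤ j ∧ j ≤ b ∧ l = seg f i j := by
  constructor
  · rintro ⟨x, y, h⟩
    have hab : a ≤ b := by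
      rw [← seg_ne_nil (f := f), ← h]; simp [hl]
    obtain ⟨m, h₁, h₂, h₃, rfl⟩ := eq_seg_of_append (by omega) h
    obtain ⟨n, h₄, h₅, rfl, rfl⟩ := eq_seg_of_append h₁ h₃
    exact ⟨n + 1, m, by omega, seg_ne_nil.1 hl, h₂, rfl⟩
  · rintro ⟨i, j, h₁, h₂, h₃, rfl⟩
    refine ⟨seg f a (i - 1), seg f (j + 1) b, ?_⟩
    have h := seg_append (f := f) (i := a) (m := i - 1) (j := j) (by omega) (by omega)
    rw [sub_add_cancel] at h
    rw [seg_append (i := a) (m := j) (by omega) h₃, h]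

theorem seg_infix_seg_iff {f g : Walk} {a b i j : ℤ} (hij : i ≤ j) :
    seg f i j <:+: seg g a b ↔ a ≤ i ∧ j ≤ b ∧ f.Agree g i j := by
  rw [infix_seg_iff (seg_ne_nil.2 hij)]
  constructor
  · rintro ⟨i', j', h₁, h₂, h₃, h⟩
    obtain ⟨rfl, rfl, hagree⟩ := seg_inj hij h
    exact ⟨h₁, h₃, hagree⟩
  · rintro ⟨h₁, h₂, h⟩
    exact ⟨i, j, h₁, hij, h₂, h.seg⟩

/-! ### Paths and kissing in terms of walks -/

/-- The walk `f` traces a path of the shape on the diagonals `a, …, b`. -/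
structure IsPath (shape : Finset (ℤ × ℤ)) (f : Walk) (a b : ℤ) : Prop where
  left : IsBoundary shape (vtx f a)
  right : IsBoundary shape (vtx f b)
  inner : ∀ d, a < d → d < b → IsInterior shape (vtx f d)

/-- The walk `f` takes both kinds of steps on the diagonals `a, …, b`. -/
def Bent (f : Walk) (a b : ℤ) : Prop :=
  (∃ d, a ≤ d ∧ d < b ∧ f.East d) ∧ ∃ d, a ≤ d ∧ d < b ∧ f.South d

/-- The walks `f` on `a, …, b` and `g` on `c, …, d` share the piece on `i, …, j`; there `f` comes
from the west and leaves to the south whereas `g` comes from the north and leaves to the east. -/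
structure Kiss (f : Walk) (a b : ℤ) (g : Walk) (c d i j : ℤ) : Prop where
  le : i ≤ j
  lt₁ : a < i
  lt₂ : j < b
  lt₃ : c < i
  lt₄ : j < d
  agree : f.Agree g i j
  east₁ : f.East (i - 1)
  south₁ : f.South j
  south₂ : g.South (i - 1)
  east₂ : g.East j

theorem isGridPath_seg_iff {shape : Finset (ℤ × ℤ)} {f : Walk} {a b : ℤ} (hab : a ≤ b) :
    IsGridPath shape (seg f a b) ↔ IsPath shape f a b := by
  have hinner : ∀ v, v ∈ (seg f a b).tail.dropLast ↔ ∃ d, a < d ∧ d < b ∧ v = vtx f d := by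
    intro v
    rw [seg_cons hab, List.tail_cons]
    rcases hab.eq_or_lt with rfl | h
    · rw [seg_eq_nil (by omega)]
      simp only [List.dropLast_nil, List.not_mem_nil, false_iff]
      rintro ⟨d, h₁, h₂, -⟩
      omega
    · rw [seg_snoc (by omega), List.dropLast_concat, mem_seg]
      constructor <;> rintro ⟨d, h₁, h₂, h₃⟩ <;> exact ⟨d, by omega, by omega, h₃⟩
  constructor
  · rintro ⟨-, -, h₁, h₂, h₃⟩
    exact ⟨h₁ _ (by simp [head?_seg hab]), h₂ _ (by simp [getLast?_seg hab]),
      fun d hd hd' => h₃ _ ((hinner _).2 ⟨d, hd, hd', rfl⟩)⟩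
  · rintro ⟨h₁, h₂, h₃⟩
    refine ⟨seg_ne_nil.2 hab, isChain_seg _ _ _, ?_, ?_, ?_⟩
    · simpa [head?_seg hab] using h₁
    · simpa [getLast?_seg hab] using h₂
    · rintro v hv
      obtain ⟨d, hd, hd', rfl⟩ := (hinner v).1 hv
      exact h₃ d hd hd'

theorem snd_eq_of_forall_east {f : Walk} {a b : ℤ} (h : ∀ d, a ≤ d → d < b → f.East d) (d : ℤ)
    (h₁ : a ≤ d) (h₂ : d ≤ b) : f d - d = f a - a := by
  induction d, h₁ using Int.leInduction with
  | base => rfl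
  | succ d h₁ ih =>
    have := h d h₁ (by omega)
    have := ih (by omega)
    unfold Walk.East at *; omega

theorem fst_eq_of_forall_south {f : Walk} {a b : ℤ} (h : ∀ d, a ≤ d → d < b → f.South d) (d : ℤ)
    (h₁ : a ≤ d) (h₂ : d ≤ b) : f d = f a := by
  induction d, h₁ using Int.leInduction with
  | base => rfl
  | succ d h₁ ih =>
    have := h d h₁ (by omega)
    have := ih (by omega)
    unfold Walk.South at *; omega

theorem bent_iff {f : Walk} {a b : ℤ} :
    Bent f a b ↔ ¬ IsHorizontal (seg f a b) ∧ ¬ IsVertical (seg f a b) := by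
  constructor
  · rintro ⟨⟨d, h₁, h₂, h₃⟩, e, h₄, h₅, h₆⟩
    constructor <;> intro h
    · have := h _ (mem_seg.2 ⟨e, h₄, h₅.le, rfl⟩) _ (mem_seg.2 ⟨e + 1, by omega, by omega, rfl⟩)
      simp only [vtx] at this
      unfold Walk.South at *; omega
    · have := h _ (mem_seg.2 ⟨d, h₁, h₂.le, rfl⟩) _ (mem_seg.2 ⟨d + 1, by omega, by omega, rfl⟩)
      simp only [vtx] at this
      unfold Walk.East at *; omega
  · rintro ⟨h₁, h₂⟩
    constructor
    · by_contra! hc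
      refine h₂ fun v hv w hw => ?_
      obtain ⟨d, hd, hd', rfl⟩ := mem_seg.1 hv
      obtain ⟨e, he, he', rfl⟩ := mem_seg.1 hw
      have hS : ∀ d, a ≤ d → d < b → f.South d := fun d h h' => Walk.south_of_not_east (hc d h h')
      exact (fst_eq_of_forall_south hS d hd hd').trans (fst_eq_of_forall_south hS e he he').symm
    · by_contra! hc
      refine h₁ fun v hv w hw => ?_
      obtain ⟨d, hd, hd', rfl⟩ := mem_seg.1 hv
      obtain ⟨e, he, he', rfl⟩ := mem_seg.1 hw
      have hE : ∀ d, a ≤ d → d < b → f.East d := fun d h h' => Walk.east_of_not_south (hc d h h')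
      exact (snd_eq_of_forall_east hE d hd hd').trans (snd_eq_of_forall_east hE e he he').symm

theorem cons_snoc_infix_iff {f g : Walk} {a b i j : ℤ} {u w : ℤ × ℤ} (hij : i ≤ j) :
    (u :: (seg f i j ++ [w])) <:+: seg g a b ↔
      a < i ∧ j < b ∧ f.Agree g i j ∧ u = vtx g (i - 1) ∧ w = vtx g (j + 1) := by
  rw [infix_seg_iff (by simp)]
  constructor
  · rintro ⟨i', j', h₁, h₂, h₃, h⟩
    have hlen := congrArg List.length h
    simp only [List.length_cons, List.length_append, length_seg, List.length_nil] at hlen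
    rw [seg_cons h₂, seg_snoc (i := i' + 1) (j := j') (by omega), List.cons_eq_cons] at h
    obtain ⟨rfl, h⟩ := h
    obtain ⟨h, hw⟩ := List.append_inj' h (by simp)
    obtain ⟨hi, hj, h⟩ := seg_inj hij h
    refine ⟨by omega, by omega, h, ?_, ?_⟩
    · congr 1; omega
    · rw [List.singleton_inj.1 hw]; congr 1; omega
  · rintro ⟨h₁, h₂, h₃, rfl, rfl⟩
    refine ⟨i - 1, j + 1, by omega, by omega, by omega, ?_⟩
    rw [seg_cons (show i - 1 ≤ j + 1 by omega), seg_snoc (j := j + 1) (by omega), sub_add_cancel,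
      add_sub_cancel_right, h₃.seg]

theorem kissAlong_seg_iff {f g h : Walk} {a b c d i j : ℤ} (hij : i ≤ j) :
    KissAlong (seg f a b) (seg g c d) (seg h i j) ↔
      Kiss f a b g c d i j ∧ h.Agree f i j := by
  constructor
  · rintro ⟨v, v', hv, hv', h₁, h₂⟩
    obtain rfl : vtx h i = v := by simpa [head?_seg hij] using hv
    obtain rfl : vtx h j = v' := by simpa [getLast?_seg hij] using hv'
    obtain ⟨a₁, a₂, a₃, a₄, a₅⟩ := (cons_snoc_infix_iff hij).1 h₁
    obtain ⟨b₁, b₂, b₃, b₄, b₅⟩ := (cons_snoc_infix_iff hij).1 h₂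
    simp only [vtx, Prod.mk.injEq] at a₄ a₅ b₄ b₅
    have e₁ := a₃ i le_rfl hij
    have e₂ := a₃ j hij le_rfl
    have e₃ := b₃ i le_rfl hij
    have e₄ := b₃ j hij le_rfl
    refine ⟨⟨hij, a₁, a₂, b₁, b₂, a₃.symm.trans b₃, ?_, ?_, ?_, ?_⟩, a₃⟩ <;>
      simp only [Walk.East, Walk.South, sub_add_cancel] <;> omega
  · rintro ⟨⟨-, h₁, h₂, h₃, h₄, h₅, h₆, h₇, h₈, h₉⟩, h₀⟩
    refine ⟨vtx h i, vtx h j, head?_seg hij, getLast?_seg hij, (cons_snoc_infix_iff hij).2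
      ⟨h₁, h₂, h₀, ?_⟩, (cons_snoc_infix_iff hij).2 ⟨h₃, h₄, h₀.trans h₅, ?_⟩⟩ <;>
    · have e₁ := h₀ i le_rfl hij
      have e₂ := h₀ j hij le_rfl
      have e₃ := h₅ i le_rfl hij
      have e₄ := h₅ j hij le_rfl
      simp only [Walk.East, Walk.South, sub_add_cancel] at h₆ h₇ h₈ h₉
      simp only [vtx, Prod.mk.injEq]
      omega

theorem exists_kiss_of_kissAlong {f g : Walk} {a b c d : ℤ} {s : List (ℤ × ℤ)}
    (h : KissAlong (seg f a b) (seg g c d) s) : ∃ i j, s = seg f i j ∧ Kiss f a b g c d i j := by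
  obtain ⟨v, v', hv, hv', h₁, h₂⟩ := id h
  have hs : s ≠ [] := by rintro rfl; simp at hv
  have hinf : s <:+: seg f a b := List.IsInfix.trans
    ⟨[(v.1 - 1, v.2)], [(v'.1, v'.2 - 1)], by simp⟩ h₁
  obtain ⟨i, j, -, hij, -, rfl⟩ := (infix_seg_iff hs).1 hinf
  exact ⟨i, j, rfl, ((kissAlong_seg_iff hij).1 h).1⟩

variable {shape : Finset (ℤ × ℤ)}

/-! ### Torsion sets of segments -/

/-- A piece `i', …, j'` of the interval `i, …, j` of the walk `f` is a quotient piece if the walk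
comes into it from the north and leaves it to the east, wherever it is cut off. -/
structure IsQuot (f : Walk) (i j i' j' : ℤ) : Prop where
  left : i ≤ i'
  le : i' ≤ j'
  right : j' ≤ j
  south : i < i' → f.South (i' - 1)
  east : j' < j → f.East j'

/-- A piece `i', …, j'` of the interval `i, …, j` of the walk `f` is a sub-piece if the walk
comes into it from the west and leaves it to the south, wherever it is cut off. -/
structure IsSub (f : Walk) (i j i' j' : ℤ) : Prop where
  left : i ≤ i'
  le : i' ≤ j'
  right : j' ≤ j
  east : i < i' → f.East (i' - 1)
  south : j' < j → f.South j'

theorem IsQuot.refl (f : Walk) {i j : ℤ} (h : i ≤ j) : IsQuot f i j i j :=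
  ⟨le_rfl, h, le_rfl, fun h => absurd h (lt_irrefl _), fun h => absurd h (lt_irrefl _)⟩

theorem IsSub.refl (f : Walk) {i j : ℤ} (h : i ≤ j) : IsSub f i j i j :=
  ⟨le_rfl, h, le_rfl, fun h => absurd h (lt_irrefl _), fun h => absurd h (lt_irrefl _)⟩

theorem IsQuot.trans {f : Walk} {i j i' j' i'' j'' : ℤ} (h : IsQuot f i j i' j')
    (h' : IsQuot f i' j' i'' j'') : IsQuot f i j i'' j'' where
  left := h.left.trans h'.left
  le := h'.le
  right := h'.right.trans h.right
  south hi := by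
    rcases h'.left.eq_or_lt with rfl | hlt
    · exact h.south hi
    · exact h'.south hlt
  east hj := by
    rcases h'.right.eq_or_lt with rfl | hlt
    · exact h.east hj
    · exact h'.east hlt

theorem IsSub.trans {f : Walk} {i j i' j' i'' j'' : ℤ} (h : IsSub f i j i' j')
    (h' : IsSub f i' j' i'' j'') : IsSub f i j i'' j'' where
  left := h.left.trans h'.left
  le := h'.le
  right := h'.right.trans h.right
  east hi := by
    rcases h'.left.eq_or_lt with rfl | hlt
    · exact h.east hi
    · exact h'.east hlt
  south hj := by
    rcases h'.right.eq_or_lt with rfl | hlt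
    · exact h.south hj
    · exact h'.south hlt

theorem IsQuot.congr {f g : Walk} {i j i' j' : ℤ} (h : IsQuot f i j i' j') (ha : f.Agree g i j) :
    IsQuot g i j i' j' :=
  have := h.left; have := h.le; have := h.right
  ⟨h.left, h.le, h.right, fun hi => ha.south (h.south hi) (by omega) (by omega),
    fun hj => ha.east (h.east hj) (by omega) (by omega)⟩

theorem IsSub.congr {f g : Walk} {i j i' j' : ℤ} (h : IsSub f i j i' j') (ha : f.Agree g i j) :
    IsSub g i j i' j' :=
  have := h.left; have := h.le; have := h.right
  ⟨h.left, h.le, h.right, fun hi => ha.east (h.east hi) (by omega) (by omega),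
    fun hj => ha.south (h.south hj) (by omega) (by omega)⟩

/-- Only the whole interval is both a quotient piece and a sub-piece. -/
theorem IsQuot.eq_of_isSub {f : Walk} {i j i' j' : ℤ} (h : IsQuot f i j i' j')
    (h' : IsSub f i j i' j') : i' = i ∧ j' = j := by
  constructor
  · by_contra hne
    have hlt : i < i' := lt_of_le_of_ne h.left (Ne.symm hne)
    exact (h.south hlt).not_east (h'.east hlt)
  · by_contra hne
    have hlt : j' < j := lt_of_le_of_ne h.right hne
    exact (h.east hlt).not_south (h'.south hlt)

/-- All vertices of `f` on the diagonals `i, …, j` are interior, and there is at least one. -/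
def IsSeg (shape : Finset (ℤ × ℤ)) (f : Walk) (i j : ℤ) : Prop :=
  i ≤ j ∧ ∀ d, i ≤ d → d ≤ j → IsInterior shape (vtx f d)

theorem IsSeg.congr {f g : Walk} {i j : ℤ} (h : IsSeg shape f i j) (ha : f.Agree g i j) :
    IsSeg shape g i j :=
  ⟨h.1, fun d hi hj => ha.vtx hi hj ▸ h.2 d hi hj⟩

theorem IsSeg.mono {f : Walk} {i j i' j' : ℤ} (h : IsSeg shape f i j) (h₁ : i ≤ i')
    (h₂ : i' ≤ j') (h₃ : j' ≤ j) : IsSeg shape f i' j' :=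
  ⟨h₂, fun d hi hj => h.2 d (h₁.trans hi) (hj.trans h₃)⟩

/-- A torsion set of segments: a set of segments that is closed under composition and under
passing to quotient pieces. The segment with vertices `vtx f i, …, vtx f j` is encoded by the
triple `f i j`, and `congr` says that membership depends on these vertices only. -/
@[ext]
structure TorsionSet (shape : Finset (ℤ × ℤ)) where
  /-- Membership of the segment traced by a walk between two diagonals. -/
  Mem : Walk → ℤ → ℤ → Prop
  congr : ∀ {f g i j}, Mem f i j → f.Agree g i j → Mem g i j
  isSeg : ∀ {f i j}, Mem f i j → IsSeg shape f i j
  append : ∀ {f i j k}, Mem f i j → Mem f (j + 1) k → Mem f i k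
  quot : ∀ {f i j i' j'}, Mem f i j → IsQuot f i j i' j' → Mem f i' j'

namespace TorsionSet

/-- The torsion-free segments of a torsion set: none of their sub-pieces belongs to it. -/
def Free (X : TorsionSet shape) (f : Walk) (i j : ℤ) : Prop :=
  IsSeg shape f i j ∧ ∀ i' j', IsSub f i j i' j' → ¬ X.Mem f i' j'

variable {X Y : TorsionSet shape} {f g : Walk} {i j k : ℤ}

theorem Free.congr (h : X.Free f i j) (ha : f.Agree g i j) : X.Free g i j :=
  ⟨h.1.congr ha, fun i' j' hs hX => h.2 i' j' (hs.congr ha.symm)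
    (X.congr hX (ha.symm.mono hs.left hs.right))⟩

theorem Free.not_mem (h : X.Free f i j) : ¬ X.Mem f i j := h.2 i j (IsSub.refl f h.1.1)

theorem Free.sub {i' j' : ℤ} (h : X.Free f i j) (hs : IsSub f i j i' j') : X.Free f i' j' :=
  ⟨h.1.mono hs.left hs.le hs.right, fun _ _ hs' => h.2 _ _ (hs.trans hs')⟩

theorem Free.append (h : X.Free f i j) (h' : X.Free f (j + 1) k) : X.Free f i k := by
  have hij := h.1.1
  have hjk := h'.1.1
  refine ⟨⟨by omega, fun d h₁ h₂ => ?_⟩, fun i' j' hs hX => ?_⟩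
  · rcases le_or_gt d j with hd | hd
    · exact h.1.2 d h₁ hd
    · exact h'.1.2 d hd h₂
  · have h₁ := hs.left
    have h₂ := hs.le
    have h₃ := hs.right
    rcases lt_or_ge j i' with hi | hi
    · exact h'.2 i' j' ⟨by omega, h₂, h₃, fun _ => hs.east (by omega), hs.south⟩ hX
    rcases le_or_gt j' j with hj | hj
    · exact h.2 i' j' ⟨h₁, h₂, hj, hs.east, fun _ => hs.south (by omega)⟩ hX
    -- The sub-piece straddles the seam; the step across the seam decides which half of it is
    -- a quotient piece, hence a member.
    rcases f.south_or_east j with hS | hE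
    · refine h'.2 (j + 1) j' ⟨le_rfl, by omega, h₃, fun h => absurd h (lt_irrefl _), hs.south⟩
        (X.quot hX ⟨by omega, by omega, le_rfl, fun _ => ?_, fun h => absurd h (lt_irrefl _)⟩)
      simpa using hS
    · exact h.2 i' j ⟨h₁, hi, le_rfl, hs.east, fun h => absurd h (lt_irrefl _)⟩
        (X.quot hX ⟨le_rfl, hi, by omega, fun h => absurd h (lt_irrefl _), fun _ => hE⟩)

/-- A segment outside a torsion set has a torsion-free quotient piece: otherwise cut it along a
sub-piece lying in the torsion set; the remaining pieces are quotient pieces, and one of them lies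
outside. -/
theorem exists_free_quot (hs : IsSeg shape f i j) (hX : ¬ X.Mem f i j) :
    ∃ i' j', IsQuot f i j i' j' ∧ X.Free f i' j' := by
  obtain ⟨n, hn⟩ : ∃ n : ℕ, n = (j - i).toNat := ⟨_, rfl⟩
  induction n using Nat.strong_induction_on generalizing i j with
  | _ n ih =>
    by_cases hF : X.Free f i j
    · exact ⟨i, j, IsQuot.refl f hs.1, hF⟩
    obtain ⟨k, l, hkl, hmem⟩ : ∃ k l, IsSub f i j k l ∧ X.Mem f k l := by
      by_contra! hc
      exact hF ⟨hs, hc⟩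
    have hik := hkl.left
    have hle := hkl.le
    have hlj := hkl.right
    have hquot : ∀ {i' j'}, IsQuot f i j i' j' → ¬ X.Mem f i' j' → j' - i' < j - i →
        ∃ i'' j'', IsQuot f i j i'' j'' ∧ X.Free f i'' j'' := by
      intro i' j' hq hnot hlt
      have := hq.le
      obtain ⟨i'', j'', hq', hF'⟩ := ih _ (by omega) (hs.mono hq.left hq.le hq.right) hnot rfl
      exact ⟨i'', j'', hq.trans hq', hF'⟩
    have hL : i < k → IsQuot f i j i (k - 1) := fun h =>
      ⟨le_rfl, by omega, by omega, fun h => absurd h (lt_irrefl _), fun _ => hkl.east h⟩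
    have hR : l < j → IsQuot f i j (l + 1) j := fun h =>
      ⟨by omega, by omega, le_rfl, fun _ => by simpa using hkl.south h,
        fun h => absurd h (lt_irrefl _)⟩
    by_cases h₁ : i < k ∧ ¬ X.Mem f i (k - 1)
    · exact hquot (hL h₁.1) h₁.2 (by omega)
    by_cases h₂ : l < j ∧ ¬ X.Mem f (l + 1) j
    · exact hquot (hR h₂.1) h₂.2 (by omega)
    have hmem' : X.Mem f i l := by
      rcases hik.eq_or_lt with rfl | h
      · exact hmem
      · have := not_not.1 (not_and.1 h₁ h)
        exact X.append this (by simpa using hmem)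
    refine absurd ?_ hX
    rcases hlj.eq_or_lt with rfl | h
    · exact hmem'
    · exact X.append hmem' (not_not.1 (not_and.1 h₂ h))

instance : PartialOrder (TorsionSet shape) where
  le X Y := ∀ ⦃f i j⦄, X.Mem f i j → Y.Mem f i j
  le_refl _ _ _ _ h := h
  le_trans _ _ _ h h' _ _ _ hm := h' (h hm)
  le_antisymm X Y h h' := TorsionSet.ext <| by
    funext f i j
    exact propext ⟨fun hm => h hm, fun hm => h' hm⟩

theorem le_def : X ≤ Y ↔ ∀ ⦃f i j⦄, X.Mem f i j → Y.Mem f i j := Iff.rfl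

theorem Free.anti (h : X ≤ Y) (hf : Y.Free f i j) : X.Free f i j :=
  ⟨hf.1, fun _ _ hs hm => hf.2 _ _ hs (h hm)⟩

/-- If `Y` is not contained in `X`, some segment of `Y` is torsion-free for `X`. -/
theorem exists_mem_free_of_not_le (h : ¬ Y ≤ X) : ∃ f i j, Y.Mem f i j ∧ X.Free f i j := by
  simp only [le_def, not_forall] at h
  obtain ⟨f, i, j, hY, hX⟩ := h
  obtain ⟨i', j', hq, hF⟩ := exists_free_quot (Y.isSeg hY) hX
  exact ⟨f, i', j', Y.quot hY hq, hF⟩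

end TorsionSet

/-- The segments composed of segments satisfying `Q`. -/
inductive Filt (Q : Walk → ℤ → ℤ → Prop) (f : Walk) : ℤ → ℤ → Prop
  | of {i j} : Q f i j → Filt Q f i j
  | append {i j k} : Filt Q f i j → Filt Q f (j + 1) k → Filt Q f i k

namespace Filt

variable {Q : Walk → ℤ → ℤ → Prop} {f g : Walk} {i j : ℤ}

theorem le (hQ : ∀ {f i j}, Q f i j → i ≤ j) (h : Filt Q f i j) : i ≤ j := by
  induction h with
  | of h => exact hQ h
  | append _ _ ih ih' => omega

theorem isSeg (hQ : ∀ {f i j}, Q f i j → IsSeg shape f i j) (h : Filt Q f i j) :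
    IsSeg shape f i j := by
  induction h with
  | of h => exact hQ h
  | @append i j k _ _ ih ih' =>
    have := ih.1
    have := ih'.1
    refine ⟨by omega, fun d h₁ h₂ => ?_⟩
    rcases le_or_gt d j with hd | hd
    · exact ih.2 d h₁ hd
    · exact ih'.2 d hd h₂

theorem congr (hle : ∀ {f i j}, Q f i j → i ≤ j)
    (hQ : ∀ {f g i j}, Q f i j → f.Agree g i j → Q g i j) (h : Filt Q f i j)
    (ha : f.Agree g i j) : Filt Q g i j := by
  induction h with
  | of h => exact of (hQ h ha)
  | append h h' ih ih' =>
    have := h.le hle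
    have := h'.le hle
    exact append (ih (ha.mono le_rfl (by omega))) (ih' (ha.mono (by omega) le_rfl))

theorem mem {X : TorsionSet shape} (hQ : ∀ {i j}, Q f i j → X.Mem f i j) (h : Filt Q f i j) :
    X.Mem f i j := by
  induction h with
  | of h => exact hQ h
  | append _ _ ih ih' => exact X.append ih ih'

/-- Among the factors of a composition, one is a sub-piece of the whole. -/
theorem exists_sub (hQ : ∀ {f i j}, Q f i j → i ≤ j) (h : Filt Q f i j) :
    ∃ i' j', IsSub f i j i' j' ∧ Q f i' j' := by
  induction h with
  | of h => exact ⟨_, _, IsSub.refl f (hQ h), h⟩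
  | @append i j k h h' ih ih' =>
    have := h.le hQ
    have := h'.le hQ
    rcases f.south_or_east j with hS | hE
    · obtain ⟨i', j', hs, hq⟩ := ih
      exact ⟨i', j', IsSub.trans ⟨le_rfl, by omega, by omega, fun h => absurd h (lt_irrefl _),
        fun _ => hS⟩ hs, hq⟩
    · obtain ⟨i', j', hs, hq⟩ := ih'
      exact ⟨i', j', IsSub.trans ⟨by omega, by omega, by omega, fun _ => by simpa using hE,
        fun h => absurd h (lt_irrefl _)⟩ hs, hq⟩

/-- Among the factors of a composition, one is a quotient piece of the whole. -/
theorem exists_quot (hQ : ∀ {f i j}, Q f i j → i ≤ j) (h : Filt Q f i j) :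
    ∃ i' j', IsQuot f i j i' j' ∧ Q f i' j' := by
  induction h with
  | of h => exact ⟨_, _, IsQuot.refl f (hQ h), h⟩
  | @append i j k h h' ih ih' =>
    have := h.le hQ
    have := h'.le hQ
    rcases f.south_or_east j with hS | hE
    · obtain ⟨i', j', hs, hq⟩ := ih'
      exact ⟨i', j', IsQuot.trans ⟨by omega, by omega, by omega, fun _ => by simpa using hS,
        fun h => absurd h (lt_irrefl _)⟩ hs, hq⟩
    · obtain ⟨i', j', hs, hq⟩ := ih
      exact ⟨i', j', IsQuot.trans ⟨le_rfl, by omega, by omega, fun h => absurd h (lt_irrefl _),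
        fun _ => hE⟩ hs, hq⟩

theorem quot (hQ : ∀ {f i j}, Q f i j → i ≤ j)
    (hquot : ∀ {f i j i' j'}, Q f i j → IsQuot f i j i' j' → Q f i' j') (h : Filt Q f i j)
    {i' j' : ℤ} (hq : IsQuot f i j i' j') : Filt Q f i' j' := by
  induction h generalizing i' j' with
  | of h => exact of (hquot h hq)
  | @append i j k h h' ih ih' =>
    have := h.le hQ
    have := h'.le hQ
    obtain ⟨h₁, h₂, h₃, h₄, h₅⟩ := hq
    rcases lt_or_ge j i' with hi | hi
    · exact ih' ⟨by omega, h₂, h₃, fun _ => h₄ (by omega), h₅⟩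
    rcases le_or_gt j' j with hj | hj
    · exact ih ⟨h₁, h₂, hj, h₄, fun _ => h₅ (by omega)⟩
    exact append (ih ⟨h₁, hi, le_rfl, h₄, fun h => absurd h (lt_irrefl _)⟩)
      (ih' ⟨le_rfl, by omega, h₃, fun h => absurd h (lt_irrefl _), h₅⟩)

end Filt

namespace TorsionSet

/-- The torsion set of all compositions of segments from a quotient-closed set of segments. -/
def gen (Q : Walk → ℤ → ℤ → Prop) (hcongr : ∀ {f g i j}, Q f i j → f.Agree g i j → Q g i j)
    (hseg : ∀ {f i j}, Q f i j → IsSeg shape f i j)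
    (hquot : ∀ {f i j i' j'}, Q f i j → IsQuot f i j i' j' → Q f i' j') : TorsionSet shape where
  Mem := Filt Q
  congr h ha := h.congr (fun h => (hseg h).1) hcongr ha
  isSeg h := h.isSeg hseg
  append := Filt.append
  quot h hq := h.quot (fun h => (hseg h).1) hquot hq

instance : Lattice (TorsionSet shape) where
  sup X Y := gen (fun f i j => X.Mem f i j ∨ Y.Mem f i j)
    (fun h ha => h.imp (X.congr · ha) (Y.congr · ha)) (fun h => h.elim X.isSeg Y.isSeg)
    (fun h hq => h.imp (X.quot · hq) (Y.quot · hq))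
  inf X Y :=
    { Mem := fun f i j => X.Mem f i j ∧ Y.Mem f i j
      congr := fun h ha => ⟨X.congr h.1 ha, Y.congr h.2 ha⟩
      isSeg := fun h => X.isSeg h.1
      append := fun h h' => ⟨X.append h.1 h'.1, Y.append h.2 h'.2⟩
      quot := fun h hq => ⟨X.quot h.1 hq, Y.quot h.2 hq⟩ }
  le_sup_left _ _ _ _ _ h := Filt.of (Or.inl h)
  le_sup_right _ _ _ _ _ h := Filt.of (Or.inr h)
  sup_le _ _ _ h h' _ _ _ hm := Filt.mem (fun hm => hm.elim (fun a => h a) (fun a => h' a)) hm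
  inf_le_left _ _ _ _ _ h := h.1
  inf_le_right _ _ _ _ _ h := h.2
  le_inf _ _ _ h h' _ _ _ hm := ⟨h hm, h' hm⟩

theorem mem_sup {X Y : TorsionSet shape} {f : Walk} {i j : ℤ} :
    (X ⊔ Y).Mem f i j ↔ Filt (fun f i j => X.Mem f i j ∨ Y.Mem f i j) f i j := Iff.rfl

/-- In a segment, one cannot compose two quotient pieces: the step between them would have to go
both east and south. -/
theorem not_isQuot_append {f : Walk} {i j a b c : ℤ} (h : IsQuot f i j a b)
    (h' : IsQuot f i j (b + 1) c) : False := by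
  have := h.left; have := h.le; have := h'.le; have := h'.right
  have h₁ := h.east (by omega)
  have h₂ := h'.south (by omega)
  rw [add_sub_cancel_right] at h₂
  exact h₁.not_south h₂

/-- The smallest torsion set containing a given segment; it consists of its quotient pieces. -/
def principal (f : Walk) (i j : ℤ) (hs : IsSeg shape f i j) : TorsionSet shape where
  Mem g k l := IsQuot f i j k l ∧ f.Agree g k l
  congr h ha := ⟨h.1, h.2.trans ha⟩
  isSeg h := (hs.mono h.1.left h.1.le h.1.right).congr h.2
  append h h' := (not_isQuot_append h.1 h'.1).elim
  quot h hq := ⟨h.1.trans (hq.congr h.2.symm), h.2.mono hq.left hq.right⟩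

/-- The proper quotient pieces of a segment: the unique lower cover of `principal`. -/
def principalStar (f : Walk) (i j : ℤ) (hs : IsSeg shape f i j) : TorsionSet shape where
  Mem g k l := (IsQuot f i j k l ∧ f.Agree g k l) ∧ ¬ (k = i ∧ l = j)
  congr h ha := ⟨⟨h.1.1, h.1.2.trans ha⟩, h.2⟩
  isSeg h := (hs.mono h.1.1.left h.1.1.le h.1.1.right).congr h.1.2
  append h h' := (not_isQuot_append h.1.1 h'.1.1).elim
  quot h hq := ⟨⟨h.1.1.trans (hq.congr h.1.2.symm), h.1.2.mono hq.left hq.right⟩, by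
    have := h.1.1.left; have := h.1.1.right; have := hq.left; have := hq.right; have := h.2
    omega⟩

theorem principal_le_iff {X : TorsionSet shape} {f : Walk} {i j : ℤ} {hs : IsSeg shape f i j} :
    principal f i j hs ≤ X ↔ X.Mem f i j :=
  ⟨fun h => h ⟨IsQuot.refl f hs.1, Walk.Agree.refl _ _ _⟩,
    fun h _ _ _ hm => X.congr (X.quot h hm.1) hm.2⟩

theorem principal_eq_of_seg_eq {f g : Walk} {i j k l : ℤ} (hs : IsSeg shape f i j)
    (hs' : IsSeg shape g k l) (h : seg f i j = seg g k l) :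
    principal f i j hs = principal g k l hs' ∧
      principalStar f i j hs = principalStar g k l hs' := by
  obtain ⟨rfl, rfl, ha⟩ := seg_inj hs.1 h
  have hiff : ∀ p a b, IsQuot f i j a b ∧ f.Agree p a b ↔ IsQuot g i j a b ∧ g.Agree p a b :=
    fun p a b => ⟨fun h => ⟨h.1.congr ha, (ha.mono h.1.left h.1.right).symm.trans h.2⟩,
      fun h => ⟨h.1.congr ha.symm, (ha.mono h.1.left h.1.right).trans h.2⟩⟩
  constructor <;> ext p a b
  · exact hiff p a b
  · exact and_congr_left fun _ => hiff p a b

/-- The pieces of `i, …, j` that do not contain `i', …, j'` and look like quotient pieces of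
`i', …, j'` wherever they end inside it. They form a torsion set which contains the proper quotient
pieces of `i', …, j'` and which generates `i, …, j` as soon as `i', …, j'` is added. -/
def avoiding (f : Walk) (i j i' j' : ℤ) (hs : IsSeg shape f i j) : TorsionSet shape where
  Mem g k l := (i ≤ k ∧ k ≤ l ∧ l ≤ j) ∧ ¬ (k ≤ i' ∧ j' ≤ l) ∧ (i' ≤ l → l < j' → f.East l) ∧
    (i' < k → k ≤ j' → f.South (k - 1)) ∧ f.Agree g k l
  congr h ha := ⟨h.1, h.2.1, h.2.2.1, h.2.2.2.1, h.2.2.2.2.trans ha⟩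
  isSeg h := (hs.mono h.1.1 h.1.2.1 h.1.2.2).congr h.2.2.2.2
  append {g k m l} := by
    rintro ⟨⟨h₁, h₂, h₃⟩, h₄, h₅, h₆, h₇⟩ ⟨⟨k₁, k₂, k₃⟩, k₄, k₅, k₆, k₇⟩
    refine ⟨⟨h₁, by omega, k₃⟩, fun hc => ?_, k₅, h₆, fun d hd hd' => ?_⟩
    · -- Neither factor contains `i', …, j'`, so the seam lies inside it.
      have hE := h₅ (by omega) (by omega)
      have hS := k₆ (by omega) (by omega)
      rw [add_sub_cancel_right] at hS
      exact hE.not_south hS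
    · rcases le_or_gt d m with hm | hm
      · exact h₇ d hd hm
      · exact k₇ d hm hd'
  quot {g k l k' l'} := by
    rintro ⟨⟨h₁, h₂, h₃⟩, h₄, h₅, h₆, h₇⟩ hq
    have := hq.left; have := hq.le; have := hq.right
    have hq' := hq.congr h₇.symm
    refine ⟨⟨by omega, by omega, by omega⟩, by omega, fun _ _ => ?_, fun _ _ => ?_,
      h₇.mono hq.left hq.right⟩
    · rcases hq.right.eq_or_lt with rfl | h
      · exact h₅ (by omega) (by omega)
      · exact hq'.east h
    · rcases hq.left.eq_or_lt with rfl | h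
      · exact h₆ (by omega) (by omega)
      · exact hq'.south h

theorem principalStar_le_avoiding {f : Walk} {i j i' j' : ℤ} (hs : IsSeg shape f i j)
    (hi : i ≤ i') (hj : j' ≤ j) (hs' : IsSeg shape f i' j') :
    principalStar f i' j' hs' ≤ avoiding f i j i' j' hs := by
  rintro g k l ⟨⟨⟨h₁, h₂, h₃, h₄, h₅⟩, ha⟩, hne⟩
  exact ⟨⟨by omega, h₂, by omega⟩, by omega, fun _ h => h₅ h, fun h _ => h₄ h, ha⟩

theorem not_mem_avoiding {f : Walk} {i j i' j' : ℤ} (hs : IsSeg shape f i j)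
    (hi : i ≤ i') (hj : j' ≤ j) : ¬ (avoiding f i j i' j' hs).Mem f i j :=
  fun h => h.2.1 ⟨hi, hj⟩

theorem mem_principal_sup_avoiding {f : Walk} {i j i' j' : ℤ} (hs : IsSeg shape f i j)
    (hi : i ≤ i') (hj : j' ≤ j) (hs' : IsSeg shape f i' j') :
    (principal f i' j' hs' ⊔ avoiding f i j i' j' hs).Mem f i j := by
  have hle := hs'.1
  have h₁ : (principal f i' j' hs' ⊔ avoiding f i j i' j' hs).Mem f i j' := by
    have h₀ : (principal f i' j' hs' ⊔ avoiding f i j i' j' hs).Mem f i' j' :=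
      (le_sup_left : principal f i' j' hs' ≤ _) (principal_le_iff.1 le_rfl)
    rcases hi.eq_or_lt with rfl | h
    · exact h₀
    · refine append (j := i' - 1) _ ((le_sup_right : avoiding f i j i' j' hs ≤ _)
        ⟨⟨le_rfl, by omega, by omega⟩, by omega, by omega, by omega, Walk.Agree.refl _ _ _⟩) ?_
      simpa using h₀
  rcases hj.eq_or_lt with rfl | h
  · exact h₁
  · exact append _ h₁ ((le_sup_right : avoiding f i j i' j' hs ≤ _)
      ⟨⟨by omega, by omega, by omega⟩, by omega, by omega, by omega, Walk.Agree.refl _ _ _⟩)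

/-- On a collection of segments closed under taking pieces, a join is determined by the restrictions
of the two torsion sets to this collection. -/
theorem mem_sup_of_restrict {X X' Y Y' : TorsionSet shape} {V : Walk → ℤ → ℤ → Prop}
    (hV : ∀ {f i j i' j'}, V f i j → i ≤ i' → i' ≤ j' → j' ≤ j → V f i' j')
    (hX : ∀ {f i j}, V f i j → X.Mem f i j → X'.Mem f i j)
    (hY : ∀ {f i j}, V f i j → Y.Mem f i j → Y'.Mem f i j) {f : Walk} {i j : ℤ}
    (hv : V f i j) (h : (X ⊔ Y).Mem f i j) : (X' ⊔ Y').Mem f i j := by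
  rw [mem_sup] at h
  induction h with
  | of h => exact Filt.of (h.imp (hX hv) (hY hv))
  | @append i j k h h' ih ih' =>
    have hle : ∀ {f i j}, X.Mem f i j ∨ Y.Mem f i j → i ≤ j :=
      fun h => h.elim (fun h => (X.isSeg h).1) (fun h => (Y.isSeg h).1)
    have := h.le hle
    have := h'.le hle
    exact (X' ⊔ Y').append (ih (hV hv le_rfl (by omega) (by omega)))
      (ih' (hV hv (by omega) (by omega) le_rfl))

end TorsionSet

/-! ### Segments of the shape as triples -/

theorem exists_isSeg_eq_seg (s : Segment shape) :
    ∃ f i j, IsSeg shape f i j ∧ s.verts = seg f i j := by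
  obtain ⟨f, i, j, hij, h⟩ := exists_seg_of_isChain s.ne_nil s.steps
  exact ⟨f, i, j, ⟨hij, fun d h₁ h₂ => s.interior _ (h ▸ mem_seg.2 ⟨d, h₁, h₂, rfl⟩)⟩, h⟩

/-- The segment traced by a walk between two diagonals. -/
def IsSeg.toSegment {f : Walk} {i j : ℤ} (h : IsSeg shape f i j) : Segment shape where
  verts := seg f i j
  ne_nil := seg_ne_nil.2 h.1
  steps := isChain_seg f i j
  interior v hv := by
    obtain ⟨d, h₁, h₂, rfl⟩ := mem_seg.1 hv
    exact h.2 d h₁ h₂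

theorem mem_of_isInterior {v : ℤ × ℤ} (h : IsInterior shape v) : v ∈ shape := by
  simpa using h 0 (by simp) 0 (by simp)

theorem vtx_injective (f : Walk) : Function.Injective (vtx f) := fun _ _ h => (vtx_inj h).1

theorem nodup_seg (f : Walk) (i j : ℤ) : (seg f i j).Nodup :=
  List.Nodup.map (fun a b h => by simpa using vtx_injective f h) List.nodup_range

instance : Finite (Segment shape) := by
  have hfin : {l : List {v // v ∈ shape} | l.length ≤ shape.card}.Finite :=
    List.finite_length_le _ _
  have : Finite {l : List {v // v ∈ shape} | l.length ≤ shape.card} := hfin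
  refine Finite.of_injective (β := {l : List {v // v ∈ shape} | l.length ≤ shape.card})
    (fun s => ⟨s.verts.attach.map fun v => ⟨v.1, mem_of_isInterior (s.interior v.1 v.2)⟩, ?_⟩)
    fun s t h => ?_
  · simp only [Set.mem_ofPred_eq, List.length_map, List.length_attach]
    obtain ⟨f, i, j, -, hs⟩ := exists_isSeg_eq_seg s
    have hnd : s.verts.Nodup := hs ▸ nodup_seg f i j
    rw [← List.toFinset_card_of_nodup hnd]
    exact Finset.card_le_card fun v hv => 
      mem_of_isInterior (s.interior v (List.mem_toFinset.1 hv))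
  · have h' := congrArg (fun l => l.1.map Subtype.val) h
    ext1
    simpa only [List.map_map, Function.comp_def, List.attach_map_subtype_val] using h'

namespace TorsionSet

/-- The members of a torsion set as a set of segments. -/
def segments (X : TorsionSet shape) : Set (Segment shape) :=
  {s | ∃ f i j, s.verts = seg f i j ∧ X.Mem f i j}

theorem toSegment_mem_segments {X : TorsionSet shape} {f : Walk} {i j : ℤ}
    (h : IsSeg shape f i j) : h.toSegment ∈ X.segments ↔ X.Mem f i j := by
  constructor
  · rintro ⟨g, k, l, he, hX⟩
    obtain ⟨rfl, rfl, ha⟩ := seg_inj h.1 he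
    exact X.congr hX ha.symm
  · exact fun hX => ⟨f, i, j, rfl, hX⟩

theorem mem_segments_iff {X : TorsionSet shape} {f : Walk} {i j : ℤ} {s : Segment shape}
    (h : IsSeg shape f i j) (hs : s.verts = seg f i j) : s ∈ X.segments ↔ X.Mem f i j := by
  obtain rfl : s = h.toSegment := Segment.ext hs
  exact toSegment_mem_segments h

theorem segments_subset_iff {X Y : TorsionSet shape} : X.segments ⊆ Y.segments ↔ X ≤ Y := by
  constructor
  · intro h f i j hX
    exact (toSegment_mem_segments (X.isSeg hX)).1 (h ((toSegment_mem_segments _).2 hX))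
  · rintro h s ⟨f, i, j, hs, hX⟩
    exact ⟨f, i, j, hs, h hX⟩

instance : Finite (TorsionSet shape) :=
  Finite.of_injective segments fun _ _ h =>
    le_antisymm (segments_subset_iff.1 h.le) (segments_subset_iff.1 h.ge)

end TorsionSet

/-! ### Extending chains compatible with a torsion set -/

/-- The walk `f` traces on `a, …, b` a chain of the shape which is compatible with the torsion set
`X`: pieces strictly inside the chain that it enters from the north and leaves to the east belong to
`X`, those that it enters from the west and leaves to the south do not. -/
structure Valid (X : TorsionSet shape) (f : Walk) (a b : ℤ) : Prop where
  mem : ∀ d, a ≤ d → d ≤ b → vtx f d ∈ shape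
  inner : ∀ d, a < d → d < b → IsInterior shape (vtx f d)
  quot : ∀ i j, a < i → i ≤ j → j < b → f.South (i - 1) → f.East j → X.Mem f i j
  sub : ∀ i j, a < i → i ≤ j → j < b → f.East (i - 1) → f.South j → ¬ X.Mem f i j

theorem vtx_succ_mem {f : Walk} {d : ℤ} (h : IsInterior shape (vtx f d)) :
    vtx f (d + 1) ∈ shape := by
  rcases f.step d with hs | hs
  · convert h 0 (by simp) (-1) (by simp) using 2 <;> (simp only [vtx, hs]; ring)
  · convert h 1 (by simp) 0 (by simp) using 2 <;> simp only [vtx, hs] <;> ring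

theorem vtx_pred_mem {f : Walk} {d : ℤ} (h : IsInterior shape (vtx f d)) :
    vtx f (d - 1) ∈ shape := by
  rcases f.step (d - 1) with hs | hs <;> rw [sub_add_cancel] at hs
  · convert h 0 (by simp) 1 (by simp) using 2 <;> simp only [vtx, hs] <;> ring
  · convert h (-1) (by simp) 0 (by simp) using 2 <;> simp only [vtx, hs] <;> ring

namespace Valid

variable {X : TorsionSet shape} {f g : Walk} {a b : ℤ}

theorem congr (h : Valid X f a b) (ha : f.Agree g a b) : Valid X g a b where
  mem d h₁ h₂ := ha.vtx h₁ h₂ ▸ h.mem d h₁ h₂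
  inner d h₁ h₂ := ha.vtx h₁.le h₂.le ▸ h.inner d h₁ h₂
  quot i j h₁ h₂ h₃ hS hE := X.congr (h.quot i j h₁ h₂ h₃
    (ha.symm.south hS (by omega) (by omega)) (ha.symm.east hE (by omega) h₃))
    (ha.mono h₁.le h₃.le)
  sub i j h₁ h₂ h₃ hE hS hX := h.sub i j h₁ h₂ h₃
    (ha.symm.east hE (by omega) (by omega)) (ha.symm.south hS (by omega) h₃)
    (X.congr hX (ha.symm.mono h₁.le h₃.le))

theorem mono (h : Valid X f a b) {a' b' : ℤ} (ha : a ≤ a') (hb : b' ≤ b) : Valid X f a' b' where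
  mem d h₁ h₂ := h.mem d (by omega) (by omega)
  inner d h₁ h₂ := h.inner d (by omega) (by omega)
  quot i j h₁ h₂ h₃ := h.quot i j (by omega) h₂ (by omega)
  sub i j h₁ h₂ h₃ := h.sub i j (by omega) h₂ (by omega)

theorem succ (h : Valid X f a b) (hi : IsInterior shape (vtx f b))
    (hE : f.East b → ∀ i, a < i → i ≤ b → f.South (i - 1) → X.Mem f i b)
    (hS : f.South b → ∀ i, a < i → i ≤ b → f.East (i - 1) → ¬ X.Mem f i b) :
    Valid X f a (b + 1) where
  mem d h₁ h₂ := by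
    rcases h₂.eq_or_lt with rfl | h₂
    · exact vtx_succ_mem hi
    · exact h.mem d h₁ (by omega)
  inner d h₁ h₂ := by
    rcases (Int.lt_add_one_iff.1 h₂).eq_or_lt with rfl | h₂
    · exact hi
    · exact h.inner d h₁ h₂
  quot i j h₁ h₂ h₃ hSi hEj := by
    rcases (Int.lt_add_one_iff.1 h₃).eq_or_lt with rfl | h₃
    · exact hE hEj i h₁ h₂ hSi
    · exact h.quot i j h₁ h₂ h₃ hSi hEj
  sub i j h₁ h₂ h₃ hEi hSj := by
    rcases (Int.lt_add_one_iff.1 h₃).eq_or_lt with rfl | h₃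
    · exact hS hSj i h₁ h₂ hEi
    · exact h.sub i j h₁ h₂ h₃ hEi hSj

theorem pred (h : Valid X f a b) (hi : IsInterior shape (vtx f a))
    (hS : f.South (a - 1) → ∀ j, a ≤ j → j < b → f.East j → X.Mem f a j)
    (hE : f.East (a - 1) → ∀ j, a ≤ j → j < b → f.South j → ¬ X.Mem f a j) :
    Valid X f (a - 1) b where
  mem d h₁ h₂ := by
    rcases h₁.eq_or_lt with rfl | h₁
    · exact vtx_pred_mem hi
    · exact h.mem d (by omega) h₂
  inner d h₁ h₂ := by
    rcases (Int.sub_one_lt_iff.1 h₁).eq_or_lt with rfl | h₁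
    · exact hi
    · exact h.inner d h₁ h₂
  quot i j h₁ h₂ h₃ hSi hEj := by
    rcases (Int.sub_one_lt_iff.1 h₁).eq_or_lt with rfl | h₁
    · exact hS hSi j h₂ h₃ hEj
    · exact h.quot i j h₁ h₂ h₃ hSi hEj
  sub i j h₁ h₂ h₃ hEi hSj := by
    rcases (Int.sub_one_lt_iff.1 h₁).eq_or_lt with rfl | h₁
    · exact hE hEi j h₂ h₃ hSj
    · exact h.sub i j h₁ h₂ h₃ hEi hSj

/-- A compatible chain ending at an interior vertex can be prolonged: if the step east were
obstructed by a suffix outside `X` and the step south by a suffix inside `X`, the longer of these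
two suffixes would contradict the closure properties of `X`. -/
theorem exists_succ (h : Valid X f a b) (hi : IsInterior shape (vtx f b)) :
    ∃ g : Walk, (∀ d ≤ b, f d = g d) ∧ Valid X g a (b + 1) := by
  by_cases hc : ∀ i, a < i → i ≤ b → f.South (i - 1) → X.Mem f i b
  · obtain ⟨g, hg, hE⟩ := f.exists_east_right b
    have ha : ∀ i, f.Agree g i b := fun i d _ hd => hg d hd
    refine ⟨g, hg, (h.congr (ha a)).succ ((ha b).vtx le_rfl le_rfl ▸ hi)
      (fun _ i h₁ h₂ hS => X.congr (hc i h₁ h₂ ((ha (i - 1)).symm.south hS le_rfl (by omega)))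
        (ha i)) (fun hS => absurd hE hS.not_east)⟩
  · push Not at hc
    obtain ⟨i, hi₁, hi₂, hSi, hXi⟩ := hc
    obtain ⟨g, hg, hS⟩ := f.exists_south_right b
    have ha : ∀ i, f.Agree g i b := fun i d _ hd => hg d hd
    refine ⟨g, hg, (h.congr (ha a)).succ ((ha b).vtx le_rfl le_rfl ▸ hi)
      (fun hE => absurd hE hS.not_east) fun _ k h₁ h₂ hE hX => hXi ?_⟩
    replace hE := (ha (k - 1)).symm.east hE le_rfl (by omega)
    replace hX := X.congr hX (ha k).symm
    rcases lt_trichotomy i k with hlt | rfl | hlt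
    · exact X.append (h.quot i (k - 1) hi₁ (by omega) (by omega) hSi hE) (by simpa using hX)
    · exact absurd hE hSi.not_east
    · exact X.quot hX ⟨hlt.le, hi₂, le_rfl, fun _ => hSi, fun h => absurd h (lt_irrefl _)⟩

theorem exists_pred (h : Valid X f a b) (hi : IsInterior shape (vtx f a)) :
    ∃ g : Walk, (∀ d, a ≤ d → f d = g d) ∧ Valid X g (a - 1) b := by
  by_cases hc : ∀ j, a ≤ j → j < b → f.East j → X.Mem f a j
  · obtain ⟨g, hg, hS⟩ := f.exists_south_left a
    have ha : ∀ j, f.Agree g a j := fun j d hd _ => hg d hd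
    refine ⟨g, hg, (h.congr (ha b)).pred ((ha a).vtx le_rfl le_rfl ▸ hi)
      (fun _ j h₁ h₂ hE => X.congr (hc j h₁ h₂ ((ha (j + 1)).symm.east hE h₁ (by omega)))
        (ha j)) (fun hE => absurd hS hE.not_south)⟩
  · push Not at hc
    obtain ⟨j, hj₁, hj₂, hEj, hXj⟩ := hc
    obtain ⟨g, hg, hE⟩ := f.exists_east_left a
    have ha : ∀ j, f.Agree g a j := fun j d hd _ => hg d hd
    refine ⟨g, hg, (h.congr (ha b)).pred ((ha a).vtx le_rfl le_rfl ▸ hi)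
      (fun hS => absurd hE hS.not_east) fun _ k h₁ h₂ hS hX => hXj ?_⟩
    replace hS := (ha (k + 1)).symm.south hS h₁ (by omega)
    replace hX := X.congr hX (ha k).symm
    rcases lt_trichotomy j k with hlt | rfl | hlt
    · exact X.quot hX ⟨le_rfl, hj₁, hlt.le, fun h => absurd h (lt_irrefl _), fun _ => hEj⟩
    · exact absurd hEj hS.not_east
    · exact X.append hX (h.quot (k + 1) j (by omega) (by omega) hj₂ (by simpa using hS) hEj)

theorem exists_right (h : Valid X f a b) (hab : a ≤ b) :
    ∃ (g : Walk) (b' : ℤ), b ≤ b' ∧ (∀ d ≤ b, f d = g d) ∧ Valid X g a b' ∧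
      IsBoundary shape (vtx g b') := by
  obtain ⟨N, hN⟩ := (shape.image fun v => v.1 - v.2).exists_le
  have hbound : ∀ {f : Walk} {b : ℤ}, vtx f b ∈ shape → b ≤ N := fun {f b} hv => by
    simpa [vtx] using hN _ (Finset.mem_image_of_mem _ hv)
  obtain ⟨n, hn⟩ : ∃ n : ℕ, n = (N - b).toNat := ⟨_, rfl⟩
  induction n generalizing f b with
  | zero =>
    refine ⟨f, b, le_rfl, fun _ _ => rfl, h, h.mem b hab le_rfl, fun hi => ?_⟩
    have := hbound (h.mem b hab le_rfl)
    have := hbound (vtx_succ_mem hi)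
    omega
  | succ n ih =>
    by_cases hi : IsInterior shape (vtx f b)
    · obtain ⟨g, hg, hv⟩ := h.exists_succ hi
      obtain ⟨g', b', h₁, h₂, h₃⟩ := ih hv (by omega) (by omega)
      exact ⟨g', b', by omega, fun d hd => (hg d hd).trans (h₂ d (by omega)), h₃⟩
    · exact ⟨f, b, le_rfl, fun _ _ => rfl, h, h.mem b hab le_rfl, hi⟩

theorem exists_left (h : Valid X f a b) (hab : a ≤ b) :
    ∃ (g : Walk) (a' : ℤ), a' ≤ a ∧ (∀ d, a ≤ d → f d = g d) ∧ Valid X g a' b ∧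
      IsBoundary shape (vtx g a') := by
  obtain ⟨N, hN⟩ := (shape.image fun v => v.2 - v.1).exists_le
  have hbound : ∀ {f : Walk} {b : ℤ}, vtx f b ∈ shape → -b ≤ N := fun {f b} hv => by
    simpa [vtx] using hN _ (Finset.mem_image_of_mem _ hv)
  obtain ⟨n, hn⟩ : ∃ n : ℕ, n = (N + a).toNat := ⟨_, rfl⟩
  induction n generalizing f a with
  | zero =>
    refine ⟨f, a, le_rfl, fun _ _ => rfl, h, h.mem a le_rfl hab, fun hi => ?_⟩
    have := hbound (h.mem a le_rfl hab)
    have := hbound (vtx_pred_mem hi)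
    omega
  | succ n ih =>
    by_cases hi : IsInterior shape (vtx f a)
    · obtain ⟨g, hg, hv⟩ := h.exists_pred hi
      obtain ⟨g', a', h₁, h₂, h₃⟩ := ih hv (by omega) (by omega)
      exact ⟨g', a', by omega, fun d hd => (hg d hd).trans (h₂ d (by omega)), h₃⟩
    · exact ⟨f, a, le_rfl, fun _ _ => rfl, h, h.mem a le_rfl hab, hi⟩

end Valid

/-! ### The facet of a torsion set -/

/-- The walk `f` traces on `a, …, b` a bent path of the shape compatible with `X`. -/
structure PathIn (X : TorsionSet shape) (f : Walk) (a b : ℤ) : Prop where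
  valid : Valid X f a b
  left : IsBoundary shape (vtx f a)
  right : IsBoundary shape (vtx f b)
  bent : Bent f a b

theorem Bent.lt {f : Walk} {a b : ℤ} (h : Bent f a b) : a < b := by
  obtain ⟨⟨d, h₁, h₂, -⟩, -⟩ := h; omega

theorem Bent.congr {f g : Walk} {a b : ℤ} (h : Bent f a b) (ha : f.Agree g a b) : Bent g a b := by
  obtain ⟨⟨d, h₁, h₂, h₃⟩, e, h₄, h₅, h₆⟩ := h
  exact ⟨⟨d, h₁, h₂, ha.east h₃ h₁ h₂⟩, e, h₄, h₅, ha.south h₆ h₄ h₅⟩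

theorem PathIn.congr {X : TorsionSet shape} {f g : Walk} {a b : ℤ} (h : PathIn X f a b)
    (ha : f.Agree g a b) : PathIn X g a b :=
  ⟨h.valid.congr ha, ha.vtx le_rfl h.bent.lt.le ▸ h.left, ha.vtx h.bent.lt.le le_rfl ▸ h.right,
    h.bent.congr ha⟩

theorem PathIn.isPath {X : TorsionSet shape} {f : Walk} {a b : ℤ} (h : PathIn X f a b) :
    IsPath shape f a b := ⟨h.left, h.right, h.valid.inner⟩

/-- A compatible chain with both kinds of steps is part of a compatible path. -/
theorem Valid.exists_pathIn {X : TorsionSet shape} {f : Walk} {a b : ℤ} (h : Valid X f a b)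
    (hb : Bent f a b) :
    ∃ (g : Walk) (a' b' : ℤ), a' ≤ a ∧ b ≤ b' ∧ f.Agree g a b ∧ PathIn X g a' b' := by
  have hab := hb.lt
  obtain ⟨g, b', hb', hg, hv, hbd⟩ := h.exists_right hab.le
  obtain ⟨g', a', ha', hg', hv', hbd'⟩ := hv.exists_left (by omega)
  have hag : f.Agree g' a b := fun d h₁ h₂ => (hg d h₂).trans (hg' d h₁)
  have hag' : g.Agree g' a b' := fun d h₁ _ => hg' d h₁
  refine ⟨g', a', b', ha', hb', hag, hv', hbd', hag'.vtx (by omega) le_rfl ▸ hbd, ?_⟩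
  obtain ⟨⟨d, h₁, h₂, h₃⟩, e, h₄, h₅, h₆⟩ := hb.congr hag
  exact ⟨⟨d, by omega, by omega, h₃⟩, e, by omega, by omega, h₆⟩

/-- The set of all bent paths compatible with a torsion set. -/
def pathSet (X : TorsionSet shape) : Set (List (ℤ × ℤ)) :=
  {l | ∃ f a b, l = seg f a b ∧ PathIn X f a b}

theorem seg_mem_pathSet {X : TorsionSet shape} {f : Walk} {a b : ℤ} (hab : a ≤ b) :
    seg f a b ∈ pathSet X ↔ PathIn X f a b := by
  constructor
  · rintro ⟨g, c, d, he, h⟩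
    obtain ⟨rfl, rfl, ha⟩ := seg_inj hab he
    exact h.congr ha.symm
  · exact fun h => ⟨f, a, b, rfl, h⟩

/-! ### Faces and the torsion sets that they generate -/

section Face

variable {F : Set (List (ℤ × ℤ))}

theorem exists_eq_seg_of_mem_face (hF : IsNonKissingFace shape F) {l : List (ℤ × ℤ)} (hl : l ∈ F) :
    ∃ f a b, l = seg f a b ∧ IsPath shape f a b ∧ Bent f a b := by
  obtain ⟨h₁, h₂⟩ := hF.1 l hl
  obtain ⟨f, a, b, hab, rfl⟩ := exists_seg_of_isChain h₁.ne_nil h₁.steps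
  exact ⟨f, a, b, rfl, (isGridPath_seg_iff hab).1 h₁, bent_iff.2 h₂⟩

theorem isPath_of_mem_face (hF : IsNonKissingFace shape F) {f : Walk} {a b : ℤ}
    (h : seg f a b ∈ F) (hab : a ≤ b) : IsPath shape f a b ∧ Bent f a b :=
  ⟨(isGridPath_seg_iff hab).1 (hF.1 _ h).1, bent_iff.2 (hF.1 _ h).2⟩

theorem not_kiss_of_mem_face (hF : IsNonKissingFace shape F) {f g : Walk} {a b c d i j : ℤ}
    (hf : seg f a b ∈ F) (hg : seg g c d ∈ F) : ¬ Kiss f a b g c d i j := by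
  intro hk
  have h₁ := hk.le; have h₂ := hk.lt₁; have h₃ := hk.lt₂
  by_cases he : seg f a b = seg g c d
  · obtain ⟨-, -, ha⟩ := seg_inj (by omega) he
    exact hk.south₂.not_east (ha.east hk.east₁ (by omega) (by omega))
  · exact hF.2 hf hg he ⟨seg f i j, Or.inl ((kissAlong_seg_iff h₁).2 ⟨hk, Walk.Agree.refl _ _ _⟩)⟩

theorem isNonKissingFace_of (h₁ : ∀ l ∈ F, ∃ f a b, l = seg f a b ∧ IsPath shape f a b ∧ Bent f a b)
    (h₂ : ∀ {f g a b c d i j}, seg f a b ∈ F → seg g c d ∈ F → ¬ Kiss f a b g c d i j) :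
    IsNonKissingFace shape F := by
  constructor
  · intro l hl
    obtain ⟨f, a, b, rfl, hp, hb⟩ := h₁ l hl
    exact ⟨(isGridPath_seg_iff hb.lt.le).2 hp, bent_iff.1 hb⟩
  · rintro l hl m hm - ⟨s, hs⟩
    obtain ⟨f, a, b, rfl, -⟩ := h₁ l hl
    obtain ⟨g, c, d, rfl, -⟩ := h₁ m hm
    rcases hs with hs | hs
    · obtain ⟨i, j, -, hk⟩ := exists_kiss_of_kissAlong hs
      exact h₂ hl hm hk
    · obtain ⟨i, j, -, hk⟩ := exists_kiss_of_kissAlong hs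
      exact h₂ hm hl hk

/-- The segment is traversed by some path of `F` that comes from the north and leaves to the
east. -/
def QuotOf (F : Set (List (ℤ × ℤ))) (f : Walk) (i j : ℤ) : Prop :=
  ∃ (g : Walk) (a b : ℤ), seg g a b ∈ F ∧ a < i ∧ i ≤ j ∧ j < b ∧ g.South (i - 1) ∧ g.East j ∧
    g.Agree f i j

/-- The segment is traversed by some path of `F` that comes from the west and leaves to the
south. -/
def SubOf (F : Set (List (ℤ × ℤ))) (f : Walk) (i j : ℤ) : Prop :=
  ∃ (g : Walk) (a b : ℤ), seg g a b ∈ F ∧ a < i ∧ i ≤ j ∧ j < b ∧ g.East (i - 1) ∧ g.South j ∧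
    g.Agree f i j

theorem QuotOf.le {f : Walk} {i j : ℤ} (h : QuotOf F f i j) : i ≤ j := by
  obtain ⟨_, _, _, _, _, h, _⟩ := h; exact h

theorem SubOf.le {f : Walk} {i j : ℤ} (h : SubOf F f i j) : i ≤ j := by
  obtain ⟨_, _, _, _, _, h, _⟩ := h; exact h

theorem QuotOf.congr {f g : Walk} {i j : ℤ} (h : QuotOf F f i j) (ha : f.Agree g i j) :
    QuotOf F g i j := by
  obtain ⟨p, a, b, h₁, h₂, h₃, h₄, h₅, h₆, h₇⟩ := h
  exact ⟨p, a, b, h₁, h₂, h₃, h₄, h₅, h₆, h₇.trans ha⟩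

theorem QuotOf.isSeg (hF : IsNonKissingFace shape F) {f : Walk} {i j : ℤ} (h : QuotOf F f i j) :
    IsSeg shape f i j := by
  obtain ⟨p, a, b, h₁, h₂, h₃, h₄, h₅, h₆, h₇⟩ := h
  have hp := (isPath_of_mem_face hF h₁ (by omega)).1
  exact IsSeg.congr ⟨h₃, fun d hd hd' => hp.inner d (by omega) (by omega)⟩ h₇

theorem QuotOf.quot {f : Walk} {i j i' j' : ℤ} (h : QuotOf F f i j) (hq : IsQuot f i j i' j') :
    QuotOf F f i' j' := by
  obtain ⟨p, a, b, h₁, h₂, h₃, h₄, h₅, h₆, h₇⟩ := h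
  have hq' := hq.congr h₇.symm
  have := hq.left; have := hq.right
  refine ⟨p, a, b, h₁, by omega, hq.le, by omega, ?_, ?_, h₇.mono hq.left hq.right⟩
  · rcases hq.left.eq_or_lt with rfl | h
    · exact h₅
    · exact hq'.south h
  · rcases hq.right.eq_or_lt with rfl | h
    · exact h₆
    · exact hq'.east h

/-- The torsion set generated by the segments that the paths of a face enter from the north and
leave to the east. -/
def torsionOf (hF : IsNonKissingFace shape F) : TorsionSet shape :=
  TorsionSet.gen (QuotOf F) QuotOf.congr (QuotOf.isSeg hF) QuotOf.quot

end Face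

/-! ### Facets correspond to torsion sets -/

section Correspondence

variable {X : TorsionSet shape} {f g : Walk} {i j : ℤ}

theorem mem_of_quotOf_pathSet (h : QuotOf (pathSet X) f i j) : X.Mem f i j := by
  obtain ⟨p, a, b, h₁, h₂, h₃, h₄, h₅, h₆, h₇⟩ := h
  exact X.congr (((seg_mem_pathSet (by omega)).1 h₁).valid.quot i j h₂ h₃ h₄ h₅ h₆) h₇

theorem free_of_subOf_pathSet (h : SubOf (pathSet X) f i j) : X.Free f i j := by
  obtain ⟨p, a, b, h₁, h₂, h₃, h₄, h₅, h₆, h₇⟩ := h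
  have hv := ((seg_mem_pathSet (by omega)).1 h₁).valid
  refine TorsionSet.Free.congr ⟨⟨h₃, fun d hd hd' => hv.inner d (by omega) (by omega)⟩,
    fun i' j' hs => ?_⟩ h₇
  have := hs.left; have := hs.right
  refine hv.sub i' j' (by omega) hs.le (by omega) ?_ ?_
  · rcases hs.left.eq_or_lt with rfl | h
    · exact h₅
    · exact hs.east h
  · rcases hs.right.eq_or_lt with rfl | h
    · exact h₆
    · exact hs.south h

theorem isNonKissingFace_pathSet (X : TorsionSet shape) : IsNonKissingFace shape (pathSet X) := by
  refine isNonKissingFace_of ?_ ?_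
  · rintro l ⟨f, a, b, rfl, h⟩
    exact ⟨f, a, b, rfl, h.isPath, h.bent⟩
  · intro f g a b c d i j hf hg hk
    have hS : SubOf (pathSet X) f i j :=
      ⟨f, a, b, hf, hk.lt₁, hk.le, hk.lt₂, hk.east₁, hk.south₁, Walk.Agree.refl _ _ _⟩
    have hQ : QuotOf (pathSet X) f i j :=
      ⟨g, c, d, hg, hk.lt₃, hk.le, hk.lt₄, hk.south₂, hk.east₂, hk.agree.symm⟩
    exact (free_of_subOf_pathSet hS).not_mem (mem_of_quotOf_pathSet hQ)

/-- A member of `X` none of whose proper sub-pieces strictly inside lies in `X` is entered from the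
north and left to the east by some path compatible with `X`. -/
theorem quotOf_pathSet_of_mem (hX : X.Mem f i j)
    (hsub : ∀ k l, i < k → k ≤ l → l < j → f.East (k - 1) → f.South l → ¬ X.Mem f k l) :
    QuotOf (pathSet X) f i j := by
  have hij := (X.isSeg hX).1
  obtain ⟨g₁, hg₁, hE⟩ := f.exists_east_right j
  obtain ⟨g, hg, hS⟩ := g₁.exists_south_left i
  have ha : f.Agree g i j := fun d h₁ h₂ => (hg₁ d h₂).trans (hg d h₁)
  have ha₁ : g₁.Agree g i (j + 1) := fun d h₁ h₂ => hg d h₁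
  replace hE := ha₁.east hE hij (by omega)
  have hseg := (X.isSeg hX).congr ha
  have hv : Valid X g (i - 1) (j + 1) := by
    refine ⟨fun d h₁ h₂ => ?_, fun d h₁ h₂ => hseg.2 d (by omega) (by omega),
      fun k l h₁ h₂ h₃ h₄ h₅ => ?_, fun k l h₁ h₂ h₃ h₄ h₅ => ?_⟩
    · rcases h₁.eq_or_lt with rfl | h₁
      · exact vtx_pred_mem (hseg.2 i le_rfl hij)
      · rcases h₂.eq_or_lt with rfl | h₂
        · exact vtx_succ_mem (hseg.2 j hij le_rfl)
        · exact mem_of_isInterior (hseg.2 d (by omega) (by omega))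
    · exact X.quot (X.congr hX ha) ⟨by omega, h₂, by omega, fun _ => h₄, fun _ => h₅⟩
    · have hik : i < k := by
        rcases (Int.sub_one_lt_iff.1 h₁).eq_or_lt with rfl | h
        · exact absurd h₄ hS.not_east
        · exact h
      have hlj : l < j := by
        rcases (Int.lt_add_one_iff.1 h₃).eq_or_lt with rfl | h
        · exact absurd h₅ hE.not_south
        · exact h
      intro hm
      exact hsub k l hik h₂ hlj (ha.symm.east h₄ (by omega) (by omega))
        (ha.symm.south h₅ (by omega) hlj) (X.congr hm (ha.symm.mono hik.le hlj.le))
  obtain ⟨p, a, b, h₁, h₂, h₃, h₄⟩ := hv.exists_pathIn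
    ⟨⟨j, by omega, by omega, hE⟩, i - 1, by omega, by omega, hS⟩
  exact ⟨p, a, b, ⟨p, a, b, rfl, h₄⟩, by omega, hij, by omega, h₃.south hS (by omega) (by omega),
    h₃.east hE (by omega) (by omega),
    (h₃.mono (by omega) (by omega)).symm.trans ha.symm⟩

theorem subOf_pathSet_of_free (hX : X.Free f i j)
    (hquot : ∀ k l, i < k → k ≤ l → l < j → f.South (k - 1) → f.East l → X.Mem f k l) :
    SubOf (pathSet X) f i j := by
  have hij := hX.1.1
  obtain ⟨g₁, hg₁, hS⟩ := f.exists_south_right j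
  obtain ⟨g, hg, hE⟩ := g₁.exists_east_left i
  have ha : f.Agree g i j := fun d h₁ h₂ => (hg₁ d h₂).trans (hg d h₁)
  have ha₁ : g₁.Agree g i (j + 1) := fun d h₁ h₂ => hg d h₁
  replace hS := ha₁.south hS hij (by omega)
  have hseg := hX.1.congr ha
  have hv : Valid X g (i - 1) (j + 1) := by
    refine ⟨fun d h₁ h₂ => ?_, fun d h₁ h₂ => hseg.2 d (by omega) (by omega),
      fun k l h₁ h₂ h₃ h₄ h₅ => ?_, fun k l h₁ h₂ h₃ h₄ h₅ => ?_⟩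
    · rcases h₁.eq_or_lt with rfl | h₁
      · exact vtx_pred_mem (hseg.2 i le_rfl hij)
      · rcases h₂.eq_or_lt with rfl | h₂
        · exact vtx_succ_mem (hseg.2 j hij le_rfl)
        · exact mem_of_isInterior (hseg.2 d (by omega) (by omega))
    · have hik : i < k := by
        rcases (Int.sub_one_lt_iff.1 h₁).eq_or_lt with rfl | h
        · exact absurd h₄ hE.not_south
        · exact h
      have hlj : l < j := by
        rcases (Int.lt_add_one_iff.1 h₃).eq_or_lt with rfl | h
        · exact absurd h₅ hS.not_east
        · exact h
      exact X.congr (hquot k l hik h₂ hlj (ha.symm.south h₄ (by omega) (by omega))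
        (ha.symm.east h₅ (by omega) hlj)) (ha.mono hik.le hlj.le)
    · exact (hX.congr ha).2 k l ⟨by omega, h₂, by omega, fun _ => h₄, fun _ => h₅⟩
  obtain ⟨p, a, b, h₁, h₂, h₃, h₄⟩ := hv.exists_pathIn
    ⟨⟨i - 1, by omega, by omega, hE⟩, j, by omega, by omega, hS⟩
  exact ⟨p, a, b, ⟨p, a, b, rfl, h₄⟩, by omega, hij, by omega, h₃.east hE (by omega) (by omega),
    h₃.south hS (by omega) (by omega),
    (h₃.mono (by omega) (by omega)).symm.trans ha.symm⟩

/-- A torsion set is generated by the quotient pieces of its compatible paths: cut a member along a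
sub-piece lying in the torsion set as long as there is one. -/
theorem filt_quotOf_pathSet (hX : X.Mem f i j) : Filt (QuotOf (pathSet X)) f i j := by
  obtain ⟨n, hn⟩ : ∃ n : ℕ, n = (j - i).toNat := ⟨_, rfl⟩
  induction n using Nat.strong_induction_on generalizing i j with
  | _ n ih =>
    by_cases h : ∀ k l, i < k → k ≤ l → l < j → f.East (k - 1) → f.South l → ¬ X.Mem f k l
    · exact Filt.of (quotOf_pathSet_of_mem hX h)
    · push Not at h
      obtain ⟨k, l, h₁, h₂, h₃, h₄, h₅, hm⟩ := h
      have hL : X.Mem f i (k - 1) :=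
        X.quot hX ⟨le_rfl, by omega, by omega, fun h => absurd h (lt_irrefl _), fun _ => h₄⟩
      have hR : X.Mem f (l + 1) j :=
        X.quot hX ⟨by omega, by omega, le_rfl, fun _ => by simpa using h₅,
          fun h => absurd h (lt_irrefl _)⟩
      refine Filt.append (j := l) (Filt.append (j := k - 1) (ih _ (by omega) hL rfl) ?_)
        (ih _ (by omega) hR rfl)
      simpa using ih _ (by omega) hm rfl

theorem filt_subOf_pathSet (hX : X.Free f i j) : Filt (SubOf (pathSet X)) f i j := by
  obtain ⟨n, hn⟩ : ∃ n : ℕ, n = (j - i).toNat := ⟨_, rfl⟩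
  induction n using Nat.strong_induction_on generalizing i j with
  | _ n ih =>
    by_cases h : ∀ k l, i < k → k ≤ l → l < j → f.South (k - 1) → f.East l → X.Mem f k l
    · exact Filt.of (subOf_pathSet_of_free hX h)
    · push Not at h
      obtain ⟨k₀, l₀, h₁, h₂, h₃, h₄, h₅, hm⟩ := h
      obtain ⟨k, l, hq, hF⟩ := TorsionSet.exists_free_quot (hX.1.mono h₁.le h₂ h₃.le) hm
      have := hq.left; have := hq.le; have := hq.right
      have hq' : IsQuot f i j k l :=
        IsQuot.trans ⟨h₁.le, h₂, h₃.le, fun _ => h₄, fun _ => h₅⟩ hq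
      have hL : X.Free f i (k - 1) := hX.sub
        ⟨le_rfl, by omega, by omega, fun h => absurd h (lt_irrefl _), fun _ => hq'.south (by omega)⟩
      have hR : X.Free f (l + 1) j := hX.sub
        ⟨by omega, by omega, le_rfl, fun _ => by simpa using hq'.east (by omega),
          fun h => absurd h (lt_irrefl _)⟩
      refine Filt.append (j := l) (Filt.append (j := k - 1) (ih _ (by omega) hL rfl) ?_)
        (ih _ (by omega) hR rfl)
      simpa using ih _ (by omega) hF rfl

theorem torsionOf_pathSet (X : TorsionSet shape) :
    torsionOf (isNonKissingFace_pathSet X) = X :=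
  le_antisymm (fun _ _ _ h => Filt.mem (fun h => mem_of_quotOf_pathSet h) h)
    fun _ _ _ h => filt_quotOf_pathSet h

theorem maximal_pathSet (X : TorsionSet shape) :
    Maximal (IsNonKissingFace shape) (pathSet X) := by
  refine ⟨isNonKissingFace_pathSet X, fun G hG hle l hl => ?_⟩
  obtain ⟨f, a, b, rfl, hp, hb⟩ := exists_eq_seg_of_mem_face hG hl
  refine (seg_mem_pathSet hb.lt.le).2 ⟨⟨fun d h₁ h₂ => ?_, hp.inner, fun i j h₁ h₂ h₃ hS hE => ?_,
    fun i j h₁ h₂ h₃ hE hS hX => ?_⟩, hp.left, hp.right, hb⟩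
  · rcases h₁.eq_or_lt with rfl | h₁
    · exact hp.left.1
    · rcases h₂.eq_or_lt with rfl | h₂
      · exact hp.right.1
      · exact mem_of_isInterior (hp.inner d h₁ h₂)
  · -- A torsion-free quotient piece would have to contain a factor along which the path kisses
    -- a path compatible with `X`.
    by_contra hX
    have hseg : IsSeg shape f i j := ⟨h₂, fun d hd hd' => hp.inner d (by omega) (by omega)⟩
    obtain ⟨i₁, j₁, hq₁, hF⟩ := TorsionSet.exists_free_quot hseg hX
    obtain ⟨k, m, hq₂, p, c, d, k₁, k₂, k₃, k₄, k₅, k₆, k₇⟩ :=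
      (filt_subOf_pathSet hF).exists_quot SubOf.le
    have hq := hq₁.trans hq₂
    have := hq.left; have := hq.right
    refine not_kiss_of_mem_face hG (hle k₁) hl (i := k) (j := m)
      ⟨k₃, k₂, k₄, by omega, by omega, k₇, k₅, k₆, ?_, ?_⟩
    · rcases hq.left.eq_or_lt with rfl | h
      · exact hS
      · exact hq.south h
    · rcases hq.right.eq_or_lt with rfl | h
      · exact hE
      · exact hq.east h
  · obtain ⟨k, m, hs, p, c, d, k₁, k₂, k₃, k₄, k₅, k₆, k₇⟩ :=
      (filt_quotOf_pathSet hX).exists_sub QuotOf.le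
    have := hs.left; have := hs.right
    refine not_kiss_of_mem_face hG hl (hle k₁) (i := k) (j := m)
      ⟨k₃, by omega, by omega, k₂, k₄, k₇.symm, ?_, ?_, k₅, k₆⟩
    · rcases hs.left.eq_or_lt with rfl | h
      · exact hE
      · exact hs.east h
    · rcases hs.right.eq_or_lt with rfl | h
      · exact hS
      · exact hs.south h

theorem subset_pathSet_torsionOf {F : Set (List (ℤ × ℤ))} (hF : IsNonKissingFace shape F) :
    F ⊆ pathSet (torsionOf hF) := by
  intro l hl
  obtain ⟨f, a, b, rfl, hp, hb⟩ := exists_eq_seg_of_mem_face hF hl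
  refine (seg_mem_pathSet hb.lt.le).2 ⟨⟨fun d h₁ h₂ => ?_, hp.inner, fun i j h₁ h₂ h₃ hS hE => ?_,
    fun i j h₁ h₂ h₃ hE hS hX => ?_⟩, hp.left, hp.right, hb⟩
  · rcases h₁.eq_or_lt with rfl | h₁
    · exact hp.left.1
    · rcases h₂.eq_or_lt with rfl | h₂
      · exact hp.right.1
      · exact mem_of_isInterior (hp.inner d h₁ h₂)
  · exact Filt.of ⟨f, a, b, hl, h₁, h₂, h₃, hS, hE, Walk.Agree.refl _ _ _⟩
  · obtain ⟨k, m, hs, p, c, d, k₁, k₂, k₃, k₄, k₅, k₆, k₇⟩ := Filt.exists_sub QuotOf.le hX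
    have := hs.left; have := hs.right
    refine not_kiss_of_mem_face hF hl k₁ (i := k) (j := m)
      ⟨k₃, by omega, by omega, k₂, k₄, k₇.symm, ?_, ?_, k₅, k₆⟩
    · rcases hs.left.eq_or_lt with rfl | h
      · exact hE
      · exact hs.east h
    · rcases hs.right.eq_or_lt with rfl | h
      · exact hS
      · exact hs.south h

/-- Facets of the non-kissing complex correspond to torsion sets: a facet consists of the bent paths
compatible with the torsion set generated by their quotient pieces. -/
def facetEquiv (shape : Finset (ℤ × ℤ)) : GridTamari shape ≃ TorsionSet shape where
  toFun F := torsionOf F.2.1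
  invFun X := ⟨pathSet X, maximal_pathSet X⟩
  left_inv F := Subtype.ext <|
    (F.2.eq_of_subset (isNonKissingFace_pathSet _) (subset_pathSet_torsionOf F.2.1)).symm
  right_inv X := torsionOf_pathSet X

end Correspondence

/-! ### Covers of torsion sets and their labels -/

/-- The segment `f i j` is the only member of `Y` that is torsion-free for the smaller torsion set
`X`. -/
structure IsLabel (X Y : TorsionSet shape) (f : Walk) (i j : ℤ) : Prop where
  le : X ≤ Y
  mem : Y.Mem f i j
  free : X.Free f i j
  unique : ∀ {g k l}, Y.Mem g k l → X.Free g k l → k = i ∧ l = j ∧ f.Agree g i j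

namespace IsLabel

variable {X Y : TorsionSet shape} {f g : Walk} {i j : ℤ}

theorem congr (h : IsLabel X Y f i j) (ha : f.Agree g i j) : IsLabel X Y g i j :=
  ⟨h.le, Y.congr h.mem ha, h.free.congr ha, fun hm hF =>
    have := h.unique hm hF
    ⟨this.1, this.2.1, ha.symm.trans this.2.2⟩⟩

theorem mem_of_isQuot (h : IsLabel X Y f i j) {k l : ℤ} (hq : IsQuot f i j k l)
    (hne : ¬ (k = i ∧ l = j)) : X.Mem f k l := by
  by_contra hX
  obtain ⟨k', l', hq', hF⟩ :=
    TorsionSet.exists_free_quot (h.free.1.mono hq.left hq.le hq.right) hX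
  obtain ⟨h₁, h₂, -⟩ := h.unique (Y.quot h.mem (hq.trans hq')) hF
  have := hq.left; have := hq.right; have := hq'.left; have := hq'.right
  omega

theorem not_mem_of_isSub (h : IsLabel X Y f i j) {k l : ℤ} (hs : IsSub f i j k l)
    (hne : ¬ (k = i ∧ l = j)) : ¬ Y.Mem f k l := fun hm =>
  have := h.unique hm (h.free.sub hs)
  hne ⟨this.1, this.2.1⟩

end IsLabel

/-- Covers have labels. Take `f i j` of minimal length among the members of `Y` that are
torsion-free for `X`. Since `Y` is generated by `X` together with any one of these segments, `f i j`
is both a sub-piece and a quotient piece of each of them, hence equal to it. -/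
theorem exists_isLabel {X Y : TorsionSet shape} (h : X ⋖ Y) : ∃ f i j, IsLabel X Y f i j := by
  have hex : ∃ n : ℕ, ∃ f i j, Y.Mem f i j ∧ X.Free f i j ∧ n = (j - i).toNat := by
    obtain ⟨f, i, j, hm, hF⟩ := TorsionSet.exists_mem_free_of_not_le h.lt.not_ge
    exact ⟨_, f, i, j, hm, hF, rfl⟩
  classical
  obtain ⟨f, i, j, hm, hF, hn⟩ := Nat.find_spec hex
  have hmin : ∀ {g k l}, Y.Mem g k l → X.Free g k l → j - i ≤ l - k := by
    intro g k l hm' hF'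
    have h₁ := Nat.find_min' hex ⟨g, k, l, hm', hF', rfl⟩
    have := hF.1.1; have := hF'.1.1
    omega
  have hgen : ∀ {g k l} (hm' : Y.Mem g k l) (hF' : X.Free g k l),
      X ⊔ TorsionSet.principal g k l hF'.1 = Y := by
    intro g k l hm' hF'
    refine (h.eq_or_eq le_sup_left
      (sup_le h.le (TorsionSet.principal_le_iff.2 hm'))).resolve_left fun he => ?_
    exact hF'.not_mem (TorsionSet.principal_le_iff.1 (sup_eq_left.1 he))
  have hpiece : ∀ {g k l g' k' l'} (hm' : Y.Mem g k l) (hF' : X.Free g k l)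
      (hm'' : Y.Mem g' k' l') (hF'' : X.Free g' k' l'), ∃ a b, IsSub g' k' l' a b ∧
        IsQuot g k l a b ∧ g.Agree g' a b := by
    intro g k l g' k' l' hm' hF' hm'' hF''
    rw [← hgen hm' hF', TorsionSet.mem_sup] at hm''
    obtain ⟨a, b, hs, hX | hq⟩ := hm''.exists_sub
      fun h => h.elim (fun h => (X.isSeg h).1) fun h => h.1.le
    · exact absurd hX (hF''.2 _ _ hs)
    · exact ⟨a, b, hs, hq.1, hq.2⟩
  refine ⟨f, i, j, h.le, hm, hF, fun {g k l} hm' hF' => ?_⟩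
  obtain ⟨a, b, hs, hq, ha⟩ := hpiece hm hF hm' hF'
  have hab : a = i ∧ b = j := by
    have := hmin (Y.congr (Y.quot hm hq) ha) (hF'.sub hs)
    have := hq.left; have := hq.right
    omega
  obtain ⟨rfl, rfl⟩ := hab
  obtain ⟨c, d, hs', hq', ha'⟩ := hpiece hm' hF' hm hF
  have hcd : c = a ∧ d = b := by
    have := hmin (Y.congr (Y.quot hm' hq') ha') (hF.sub hs')
    have := hs'.left; have := hs'.right
    omega
  obtain ⟨rfl, rfl⟩ := hcd
  obtain ⟨rfl, rfl⟩ := hq'.eq_of_isSub hs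
  exact ⟨rfl, rfl, ha⟩

/-! ### Covers are flips -/

theorem eq_or_diverge_right {p q : Walk} {a b c d i j : ℤ} (hp : IsPath shape p a b)
    (hq : IsPath shape q c d) (ha : p.Agree q i j) (hij : i ≤ j) (h₁ : a < j) (h₂ : j < b)
    (h₃ : c < j) (h₄ : j < d) :
    (b = d ∧ p.Agree q i b) ∨
      ∃ k, j ≤ k ∧ k < b ∧ k < d ∧ p.Agree q i k ∧ p (k + 1) ≠ q (k + 1) := by
  obtain ⟨n, hn⟩ : ∃ n : ℕ, n = (b - j).toNat := ⟨_, rfl⟩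
  induction n generalizing j with
  | zero => omega
  | succ n ih =>
    by_cases he : p (j + 1) = q (j + 1)
    · have ha' : p.Agree q i (j + 1) := by
        intro e h h'
        rcases h'.eq_or_lt with rfl | h'
        · exact he
        · exact ha e h (by omega)
      have hv := ha'.vtx (by omega) le_rfl
      rcases (Int.add_one_le_iff.2 h₂).eq_or_lt with rfl | hb
      · rcases (Int.add_one_le_iff.2 h₄).eq_or_lt with rfl | hd
        · exact Or.inl ⟨rfl, ha'⟩
        · exact absurd (hv ▸ hq.inner (j + 1) (by omega) hd) hp.right.2
      · rcases (Int.add_one_le_iff.2 h₄).eq_or_lt with rfl | hd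
        · exact absurd (hv ▸ hp.inner (j + 1) (by omega) hb) hq.right.2
        · rcases ih ha' (by omega) (by omega) hb (by omega) hd (by omega) with h | ⟨k, hk, h⟩
          · exact Or.inl h
          · exact Or.inr ⟨k, by omega, h⟩
    · exact Or.inr ⟨j, le_rfl, h₂, h₄, ha, he⟩

theorem eq_or_diverge_left {p q : Walk} {a b c d i j : ℤ} (hp : IsPath shape p a b)
    (hq : IsPath shape q c d) (ha : p.Agree q i j) (hij : i ≤ j) (h₁ : a < i) (h₂ : i < b)
    (h₃ : c < i) (h₄ : i < d) :
    (a = c ∧ p.Agree q a j) ∨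
      ∃ k, k ≤ i ∧ a < k ∧ c < k ∧ p.Agree q k j ∧ p (k - 1) ≠ q (k - 1) := by
  obtain ⟨n, hn⟩ : ∃ n : ℕ, n = (i - a).toNat := ⟨_, rfl⟩
  induction n generalizing i with
  | zero => omega
  | succ n ih =>
    by_cases he : p (i - 1) = q (i - 1)
    · have ha' : p.Agree q (i - 1) j := by
        intro e h h'
        rcases h.eq_or_lt with rfl | h
        · exact he
        · exact ha e (by omega) h'
      have hv := ha'.vtx le_rfl (by omega)
      rcases (Int.le_sub_one_iff.2 h₁).eq_or_lt with rfl | hb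
      · rcases (Int.le_sub_one_iff.2 h₃).eq_or_lt with rfl | hd
        · exact Or.inl ⟨rfl, ha'⟩
        · exact absurd (hv ▸ hq.inner (i - 1) hd (by omega)) hp.left.2
      · rcases (Int.le_sub_one_iff.2 h₃).eq_or_lt with rfl | hd
        · exact absurd (hv ▸ hp.inner (i - 1) hb (by omega)) hq.left.2
        · rcases ih ha' (by omega) hb (by omega) hd (by omega) (by omega) with h | ⟨k, hk, h⟩
          · exact Or.inl h
          · exact Or.inr ⟨k, by omega, h⟩
    · exact Or.inr ⟨i, le_rfl, h₁, h₃, ha, he⟩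

theorem south_east_of_ne_right {p q : Walk} {i k : ℤ} (ha : p.Agree q i k) (hik : i ≤ k)
    (hne : p (k + 1) ≠ q (k + 1)) : p.East k ∧ q.South k ∨ p.South k ∧ q.East k := by
  have h := ha k hik le_rfl
  have h₁ := p.step k
  have h₂ := q.step k
  unfold Walk.East Walk.South
  omega

theorem south_east_of_ne_left {p q : Walk} {k j : ℤ} (ha : p.Agree q k j) (hkj : k ≤ j)
    (hne : p (k - 1) ≠ q (k - 1)) :
    p.East (k - 1) ∧ q.South (k - 1) ∨ p.South (k - 1) ∧ q.East (k - 1) := by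
  have h := ha k le_rfl hkj
  have h₁ := p.step (k - 1)
  have h₂ := q.step (k - 1)
  unfold Walk.East Walk.South
  rw [sub_add_cancel] at *
  omega

/-- The path `p` traverses `i, …, j` coming from the west and leaving to the south. -/
structure Under (p : Walk) (a b i j : ℤ) : Prop where
  lt₁ : a < i
  le : i ≤ j
  lt₂ : j < b
  east : p.East (i - 1)
  south : p.South j

/-- The path `p` traverses `i, …, j` coming from the north and leaving to the east. -/
structure Over (p : Walk) (a b i j : ℤ) : Prop where
  lt₁ : a < i
  le : i ≤ j
  lt₂ : j < b
  south : p.South (i - 1)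
  east : p.East j

theorem PathIn.mem {X : TorsionSet shape} {p : Walk} {a b i j : ℤ} (h : PathIn X p a b)
    (ho : Over p a b i j) : X.Mem p i j :=
  h.valid.quot i j ho.lt₁ ho.le ho.lt₂ ho.south ho.east

theorem PathIn.free {X : TorsionSet shape} {p : Walk} {a b i j : ℤ} (h : PathIn X p a b)
    (hu : Under p a b i j) : X.Free p i j :=
  free_of_subOf_pathSet
    ⟨p, a, b, ⟨p, a, b, rfl, h⟩, hu.lt₁, hu.le, hu.lt₂, hu.east, hu.south, Walk.Agree.refl _ _ _⟩

namespace IsLabel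

variable {X Y : TorsionSet shape} {p q f : Walk} {a b c d i j : ℤ}

/-- Only one path compatible with `X` lies under the label. Where two such paths diverge, the label
could be prolonged to a longer member of `Y` that is torsion-free for `X`. -/
theorem under_unique (h : IsLabel X Y p i j) (hp : PathIn X p a b) (hq : PathIn X q c d)
    (hup : Under p a b i j) (huq : Under q c d i j) (ha : p.Agree q i j) :
    a = c ∧ b = d ∧ p.Agree q a b := by
  have hij := hup.le
  have := hup.lt₁; have := hup.lt₂; have := huq.lt₁; have := huq.lt₂
  have right : ∀ {p q a b c d} (_ : IsLabel X Y p i j) (_ : PathIn X p a b) (_ : PathIn X q c d)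
      (_ : Under p a b i j) (_ : Under q c d i j) {k} (_ : p.Agree q i k) (_ : j ≤ k) (_ : k < b)
      (_ : k < d) (_ : p.East k) (_ : q.South k), False := by
    intro p q a b c d h hp hq hup huq k ha hjk hb hd hE hS
    have := hup.lt₁
    rcases hjk.eq_or_lt with rfl | hjk
    · exact hup.south.not_east hE
    have h₁ := hq.free (i := i) (j := k) ⟨huq.lt₁, by omega, hd, huq.east, hS⟩
    have h₂ : X.Mem p (j + 1) k :=
      hp.mem ⟨by omega, by omega, hb, by simpa using hup.south, hE⟩
    have h₃ := h.unique (Y.append h.mem (h.le h₂)) (h₁.congr ha.symm)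
    omega
  have left : ∀ {p q a b c d} (_ : IsLabel X Y p i j) (_ : PathIn X p a b) (_ : PathIn X q c d)
      (_ : Under p a b i j) (_ : Under q c d i j) {k} (_ : p.Agree q k j) (_ : k ≤ i) (_ : a < k)
      (_ : c < k) (_ : p.South (k - 1)) (_ : q.East (k - 1)), False := by
    intro p q a b c d h hp hq hup huq k ha hki hb hd hS hE
    have := hup.lt₂
    rcases hki.eq_or_lt with rfl | hki
    · exact hup.east.not_south hS
    have h₁ := hq.free (i := k) (j := j) ⟨hd, by omega, huq.lt₂, hE, huq.south⟩
    have h₂ : X.Mem p k (i - 1) := hp.mem ⟨hb, by omega, by omega, hS, hup.east⟩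
    have h₃ := h.unique (Y.append (h.le h₂) (by simpa using h.mem)) (h₁.congr ha.symm)
    omega
  have hr : b = d ∧ p.Agree q i b := by
    refine (eq_or_diverge_right hp.isPath hq.isPath ha hij (by omega) (by omega) (by omega)
      (by omega)).resolve_right ?_
    rintro ⟨k, h₁, h₂, h₃, h₄, h₅⟩
    rcases south_east_of_ne_right h₄ (by omega) h₅ with ⟨hE, hS⟩ | ⟨hS, hE⟩
    · exact right h hp hq hup huq h₄ h₁ h₂ h₃ hE hS
    · exact right (h.congr ha) hq hp huq hup h₄.symm h₁ h₃ h₂ hE hS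
  have hl : a = c ∧ p.Agree q a j := by
    refine (eq_or_diverge_left hp.isPath hq.isPath ha hij (by omega) (by omega) (by omega)
      (by omega)).resolve_right ?_
    rintro ⟨k, h₁, h₂, h₃, h₄, h₅⟩
    rcases south_east_of_ne_left h₄ (by omega) h₅ with ⟨hE, hS⟩ | ⟨hS, hE⟩
    · exact left (h.congr ha) hq hp huq hup h₄.symm h₁ h₃ h₂ hS hE
    · exact left h hp hq hup huq h₄ h₁ h₂ h₃ hS hE
  refine ⟨hl.1, hr.1, fun e h₁ h₂ => ?_⟩
  rcases le_total e j with he | he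
  · exact hl.2 e h₁ he
  · exact hr.2 e (by omega) h₂

/-- Only one path compatible with `Y` lies over the label. -/
theorem over_unique (h : IsLabel X Y p i j) (hp : PathIn Y p a b) (hq : PathIn Y q c d)
    (hup : Over p a b i j) (huq : Over q c d i j) (ha : p.Agree q i j) :
    a = c ∧ b = d ∧ p.Agree q a b := by
  have hij := hup.le
  have := hup.lt₁; have := hup.lt₂; have := huq.lt₁; have := huq.lt₂
  have right : ∀ {p q a b c d} (_ : IsLabel X Y q i j) (_ : PathIn Y p a b) (_ : PathIn Y q c d)
      (_ : Over p a b i j) (_ : Over q c d i j) {k} (_ : p.Agree q i k) (_ : j ≤ k) (_ : k < b)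
      (_ : k < d) (_ : p.East k) (_ : q.South k), False := by
    intro p q a b c d h hp hq hup huq k ha hjk hb hd hE hS
    have := huq.lt₁
    rcases hjk.eq_or_lt with rfl | hjk
    · exact hS.not_east huq.east
    have h₁ : Y.Mem p i k := hp.mem ⟨hup.lt₁, by omega, hb, hup.south, hE⟩
    have h₂ : Y.Free q (j + 1) k :=
      hq.free ⟨by omega, by omega, hd, by simpa using huq.east, hS⟩
    have h₃ := h.unique (Y.congr h₁ ha) (h.free.append (TorsionSet.Free.anti h.le h₂))
    omega
  have left : ∀ {p q a b c d} (_ : IsLabel X Y q i j) (_ : PathIn Y p a b) (_ : PathIn Y q c d)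
      (_ : Over p a b i j) (_ : Over q c d i j) {k} (_ : p.Agree q k j) (_ : k ≤ i) (_ : a < k)
      (_ : c < k) (_ : p.South (k - 1)) (_ : q.East (k - 1)), False := by
    intro p q a b c d h hp hq hup huq k ha hki hb hd hS hE
    have := huq.lt₂
    rcases hki.eq_or_lt with rfl | hki
    · exact hE.not_south huq.south
    have h₁ : Y.Mem p k j := hp.mem ⟨hb, by omega, hup.lt₂, hS, hup.east⟩
    have h₂ : Y.Free q k (i - 1) := hq.free ⟨hd, by omega, by omega, hE, huq.south⟩
    have h₃ := h.unique (Y.congr h₁ ha)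
      ((TorsionSet.Free.anti h.le h₂).append (by simpa using h.free))
    omega
  have hr : b = d ∧ p.Agree q i b := by
    refine (eq_or_diverge_right hp.isPath hq.isPath ha hij (by omega) (by omega) (by omega)
      (by omega)).resolve_right ?_
    rintro ⟨k, h₁, h₂, h₃, h₄, h₅⟩
    rcases south_east_of_ne_right h₄ (by omega) h₅ with ⟨hE, hS⟩ | ⟨hS, hE⟩
    · exact right (h.congr ha) hp hq hup huq h₄ h₁ h₂ h₃ hE hS
    · exact right h hq hp huq hup h₄.symm h₁ h₃ h₂ hE hS
  have hl : a = c ∧ p.Agree q a j := by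
    refine (eq_or_diverge_left hp.isPath hq.isPath ha hij (by omega) (by omega) (by omega)
      (by omega)).resolve_right ?_
    rintro ⟨k, h₁, h₂, h₃, h₄, h₅⟩
    rcases south_east_of_ne_left h₄ (by omega) h₅ with ⟨hE, hS⟩ | ⟨hS, hE⟩
    · exact left h hq hp huq hup h₄.symm h₁ h₃ h₂ hS hE
    · exact left (h.congr ha) hp hq hup huq h₄ h₁ h₂ h₃ hS hE
  refine ⟨hl.1, hr.1, fun e h₁ h₂ => ?_⟩
  rcases le_total e j with he | he
  · exact hl.2 e h₁ he
  · exact hr.2 e (by omega) h₂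

/-- The only path that is compatible with `X` but not with `Y` is the one under the label. -/
theorem exists_sdiff_eq (h : IsLabel X Y f i j) :
    ∃ p a b, PathIn X p a b ∧ Under p a b i j ∧ p.Agree f i j ∧
      pathSet X \ pathSet Y = {seg p a b} := by
  obtain ⟨p, a, b, hp, h₁, h₂, h₃, h₄, h₅, ha⟩ := subOf_pathSet_of_free h.free
    fun k l h₁ h₂ h₃ hS hE => h.mem_of_isQuot ⟨h₁.le, h₂, h₃.le, fun _ => hS, fun _ => hE⟩
      (by omega)
  have hp' := (seg_mem_pathSet (by omega)).1 hp
  have hu : Under p a b i j := ⟨h₁, h₂, h₃, h₄, h₅⟩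
  refine ⟨p, a, b, hp', hu, ha, Set.eq_singleton_iff_unique_mem.2 ⟨⟨hp, fun hY => ?_⟩, ?_⟩⟩
  · exact (((seg_mem_pathSet (by omega)).1 hY).free hu).not_mem (Y.congr h.mem ha.symm)
  · rintro _ ⟨⟨q, c, d, rfl, hq⟩, hY⟩
    obtain ⟨k, l, hkl, hm⟩ : ∃ k l, Under q c d k l ∧ Y.Mem q k l := by
      by_contra! hc
      exact hY ⟨q, c, d, rfl, ⟨hq.valid.mem, hq.valid.inner,
        fun k l k₁ k₂ k₃ k₄ k₅ => h.le (hq.valid.quot k l k₁ k₂ k₃ k₄ k₅),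
        fun k l k₁ k₂ k₃ k₄ k₅ => hc k l ⟨k₁, k₂, k₃, k₄, k₅⟩⟩, hq.left, hq.right, hq.bent⟩
    obtain ⟨rfl, rfl, ha'⟩ := h.unique hm (hq.free hkl)
    obtain ⟨rfl, rfl, ha''⟩ :=
      (h.congr ha.symm).under_unique hp' hq hu hkl (ha.trans ha')
    exact ha''.symm.seg

/-- The only path that is compatible with `Y` but not with `X` is the one over the label. -/
theorem exists_sdiff_eq' (h : IsLabel X Y f i j) :
    ∃ p a b, PathIn Y p a b ∧ Over p a b i j ∧ p.Agree f i j ∧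
      pathSet Y \ pathSet X = {seg p a b} := by
  obtain ⟨p, a, b, hp, h₁, h₂, h₃, h₄, h₅, ha⟩ := quotOf_pathSet_of_mem h.mem
    fun k l h₁ h₂ h₃ hE hS => h.not_mem_of_isSub ⟨h₁.le, h₂, h₃.le, fun _ => hE, fun _ => hS⟩
      (by omega)
  have hp' := (seg_mem_pathSet (by omega)).1 hp
  have hu : Over p a b i j := ⟨h₁, h₂, h₃, h₄, h₅⟩
  refine ⟨p, a, b, hp', hu, ha, Set.eq_singleton_iff_unique_mem.2 ⟨⟨hp, fun hX => ?_⟩, ?_⟩⟩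
  · exact h.free.not_mem (X.congr (((seg_mem_pathSet (by omega)).1 hX).mem hu) ha)
  · rintro _ ⟨⟨q, c, d, rfl, hq⟩, hX⟩
    obtain ⟨k, l, hkl, hm⟩ : ∃ k l, Over q c d k l ∧ ¬ X.Mem q k l := by
      by_contra! hc
      exact hX ⟨q, c, d, rfl, ⟨hq.valid.mem, hq.valid.inner,
        fun k l k₁ k₂ k₃ k₄ k₅ => hc k l ⟨k₁, k₂, k₃, k₄, k₅⟩,
        fun k l k₁ k₂ k₃ k₄ k₅ hm => hq.valid.sub k l k₁ k₂ k₃ k₄ k₅ (h.le hm)⟩,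
        hq.left, hq.right, hq.bent⟩
    obtain ⟨k', l', hq', hF⟩ := TorsionSet.exists_free_quot (Y.isSeg (hq.mem hkl)) hm
    have hle := hkl.le; have hlt₁ := hkl.lt₁; have hlt₂ := hkl.lt₂
    have := hq'.left; have := hq'.right
    have hkl' : Over q c d k' l' := by
      refine ⟨by omega, hq'.le, by omega, ?_, ?_⟩
      · rcases hq'.left.eq_or_lt with rfl | h
        · exact hkl.south
        · exact hq'.south h
      · rcases hq'.right.eq_or_lt with rfl | h
        · exact hkl.east
        · exact hq'.east h
    obtain ⟨rfl, rfl, ha'⟩ := h.unique (hq.mem hkl') hF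
    obtain ⟨rfl, rfl, ha''⟩ :=
      (h.congr ha.symm).over_unique hp' hq hu hkl' (ha.trans ha')
    exact ha''.symm.seg

theorem flip (h : IsLabel X Y f i j) {s : Segment shape} (hs : s.verts = seg f i j) :
    GridTamari.Flip s ((facetEquiv shape).symm X) ((facetEquiv shape).symm Y) := by
  obtain ⟨p, a, b, hp, hu, ha, he⟩ := h.exists_sdiff_eq
  obtain ⟨q, c, d, hq, ho, ha', he'⟩ := h.exists_sdiff_eq'
  refine ⟨seg p a b, seg q c d, he, he', ?_⟩
  rw [hs, kissAlong_seg_iff hu.le]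
  exact ⟨⟨hu.le, hu.lt₁, hu.lt₂, ho.lt₁, ho.lt₂, ha.trans ha'.symm, hu.east, hu.south, ho.south,
    ho.east⟩, ha.symm⟩

end IsLabel

/-! ### Flips are covers -/

section Middle

variable {X Y Z : TorsionSet shape} {p : Walk} {a b i₁ j₁ i₃ j₃ : ℤ}

/-- The steps of the path under a label are forced: turning south instead of east beyond the label
would give a second path under the label, unless some suffix lies in `X`. -/
theorem exists_suffix_of_under (h : IsLabel X Y p i₁ j₁) (hp : PathIn X p a b)
    (hu : Under p a b i₁ j₁) {l : ℤ} (h₁ : j₁ < l) (h₂ : l < b) (hE : p.East l) :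
    ∃ k, i₁ ≤ k ∧ k ≤ l ∧ p.East (k - 1) ∧ X.Mem p k l := by
  by_contra! hc
  have hle := hu.le; have hlt₁ := hu.lt₁
  obtain ⟨g, hg, hS⟩ := p.exists_south_right l
  have ha : p.Agree g (i₁ - 1) l := fun d _ hd => hg d hd
  have hv : Valid X g (i₁ - 1) (l + 1) := by
    refine ((hp.valid.mono (a' := i₁ - 1) (b' := l) (by omega) h₂.le).congr ha).succ
      (ha.vtx (by omega) le_rfl ▸ hp.valid.inner l (by omega) h₂)
      (fun hE' => absurd hE' hS.not_east) fun _ k k₁ k₂ hE' hm => ?_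
    exact hc k (by omega) k₂ (ha.symm.east hE' (by omega) (by omega))
      (X.congr hm (ha.symm.mono (by omega) le_rfl))
  obtain ⟨q, c, d, h₃, h₄, h₅, hq⟩ := hv.exists_pathIn
    ⟨⟨i₁ - 1, le_rfl, by omega, ha.east hu.east le_rfl (by omega)⟩, l, by omega, by omega, hS⟩
  have ha' : p.Agree q (i₁ - 1) l := ha.trans (h₅.mono le_rfl (by omega))
  obtain ⟨-, -, ha''⟩ := h.under_unique hp hq hu ⟨by omega, hle, by omega,
    ha'.east hu.east le_rfl (by omega), ha'.south hu.south (by omega) (by omega)⟩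
    (ha'.mono (by omega) (by omega))
  exact (h₅.south hS (by omega) (by omega)).not_east (ha''.east hE (by omega) (by omega))

theorem exists_prefix_of_under (h : IsLabel X Y p i₁ j₁) (hp : PathIn X p a b)
    (hu : Under p a b i₁ j₁) {l : ℤ} (h₁ : l < i₁) (h₂ : a < l) (hS : p.South (l - 1)) :
    ∃ k, l ≤ k ∧ k ≤ j₁ ∧ p.South k ∧ X.Mem p l k := by
  by_contra! hc
  have hle := hu.le; have hlt₂ := hu.lt₂
  obtain ⟨g, hg, hE⟩ := p.exists_east_left l
  have ha : p.Agree g l (j₁ + 1) := fun d hd _ => hg d hd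
  have hv : Valid X g (l - 1) (j₁ + 1) := by
    refine ((hp.valid.mono (a' := l) (b' := j₁ + 1) h₂.le (by omega)).congr ha).pred
      (ha.vtx le_rfl (by omega) ▸ hp.valid.inner l h₂ (by omega))
      (fun hS' => absurd hE hS'.not_east) fun _ k k₁ k₂ hS' hm => ?_
    exact hc k k₁ (by omega) (ha.symm.south hS' (by omega) (by omega))
      (X.congr hm (ha.symm.mono le_rfl (by omega)))
  obtain ⟨q, c, d, h₃, h₄, h₅, hq⟩ := hv.exists_pathIn
    ⟨⟨l - 1, le_rfl, by omega, hE⟩, j₁, by omega, by omega, ha.south hu.south (by omega) (by omega)⟩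
  have ha' : p.Agree q l (j₁ + 1) := ha.trans (h₅.mono (by omega) le_rfl)
  obtain ⟨-, -, ha''⟩ := h.under_unique hp hq hu ⟨by omega, hle, by omega,
    ha'.east hu.east (by omega) (by omega), ha'.south hu.south (by omega) (by omega)⟩
    (ha'.mono (by omega) (by omega))
  exact (h₅.east hE (by omega) (by omega)).not_south (ha''.south hS (by omega) (by omega))

theorem exists_prefix_of_over (h : IsLabel Z X p i₃ j₃) (hp : PathIn X p a b)
    (ho : Over p a b i₃ j₃) {l : ℤ} (h₁ : l < i₃) (h₂ : a < l) (hE : p.East (l - 1)) :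
    ∃ k, l ≤ k ∧ k ≤ j₃ ∧ p.East k ∧ ¬ X.Mem p l k := by
  by_contra! hc
  have hle := ho.le; have hlt₂ := ho.lt₂
  obtain ⟨g, hg, hS⟩ := p.exists_south_left l
  have ha : p.Agree g l (j₃ + 1) := fun d hd _ => hg d hd
  have hv : Valid X g (l - 1) (j₃ + 1) := by
    refine ((hp.valid.mono (a' := l) (b' := j₃ + 1) h₂.le (by omega)).congr ha).pred
      (ha.vtx le_rfl (by omega) ▸ hp.valid.inner l h₂ (by omega)) (fun _ k k₁ k₂ hE' => ?_)
      fun hE' => absurd hE' hS.not_east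
    exact X.congr (hc k k₁ (by omega) (ha.symm.east hE' (by omega) (by omega)))
      (ha.mono le_rfl (by omega))
  obtain ⟨q, c, d, h₃, h₄, h₅, hq⟩ := hv.exists_pathIn
    ⟨⟨j₃, by omega, by omega, ha.east ho.east (by omega) (by omega)⟩, l - 1, le_rfl, by omega, hS⟩
  have ha' : p.Agree q l (j₃ + 1) := ha.trans (h₅.mono (by omega) le_rfl)
  obtain ⟨-, -, ha''⟩ := h.over_unique hp hq ho ⟨by omega, hle, by omega,
    ha'.south ho.south (by omega) (by omega), ha'.east ho.east (by omega) (by omega)⟩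
    (ha'.mono (by omega) (by omega))
  exact (h₅.south hS (by omega) (by omega)).not_east (ha''.east hE (by omega) (by omega))

theorem exists_suffix_of_over (h : IsLabel Z X p i₃ j₃) (hp : PathIn X p a b)
    (ho : Over p a b i₃ j₃) {l : ℤ} (h₁ : j₃ < l) (h₂ : l < b) (hS : p.South l) :
    ∃ k, i₃ ≤ k ∧ k ≤ l ∧ p.South (k - 1) ∧ ¬ X.Mem p k l := by
  by_contra! hc
  have hle := ho.le; have hlt₁ := ho.lt₁
  obtain ⟨g, hg, hE⟩ := p.exists_east_right l
  have ha : p.Agree g (i₃ - 1) l := fun d _ hd => hg d hd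
  have hv : Valid X g (i₃ - 1) (l + 1) := by
    refine ((hp.valid.mono (a' := i₃ - 1) (b' := l) (by omega) h₂.le).congr ha).succ
      (ha.vtx (by omega) le_rfl ▸ hp.valid.inner l (by omega) h₂) (fun _ k k₁ k₂ hS' => ?_)
      fun hS' => absurd hE hS'.not_east
    exact X.congr (hc k (by omega) k₂ (ha.symm.south hS' (by omega) (by omega)))
      (ha.mono (by omega) le_rfl)
  obtain ⟨q, c, d, h₃, h₄, h₅, hq⟩ := hv.exists_pathIn
    ⟨⟨l, by omega, by omega, hE⟩, i₃ - 1, le_rfl, by omega, ha.south ho.south le_rfl (by omega)⟩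
  have ha' : p.Agree q (i₃ - 1) l := ha.trans (h₅.mono le_rfl (by omega))
  obtain ⟨-, -, ha''⟩ := h.over_unique hp hq ho ⟨by omega, hle, by omega,
    ha'.south ho.south le_rfl (by omega), ha'.east ho.east (by omega) (by omega)⟩
    (ha'.mono (by omega) (by omega))
  exact (h₅.east hE (by omega) (by omega)).not_south (ha''.south hS (by omega) (by omega))

/-- The path exchanged along a cover above `X` is never the path exchanged along a cover below `X`.
Otherwise the path is determined by either label alone, so that turning off at any of its steps
violates a constraint coming from `X`; the constraints obtained from the two labels are
contradictory. -/
theorem IsLabel.not_under_and_over (h₁ : IsLabel X Y p i₁ j₁) (h₃ : IsLabel Z X p i₃ j₃)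
    (hp : PathIn X p a b) (hu : Under p a b i₁ j₁) (ho : Over p a b i₃ j₃) : False := by
  have hle₁ := hu.le; have hlt₁ := hu.lt₁; have hlt₁' := hu.lt₂
  have hle₃ := ho.le; have hlt₃ := ho.lt₁; have hlt₃' := ho.lt₂
  have hi : i₁ ≠ i₃ := by
    rintro rfl
    exact hu.east.not_south ho.south
  have hj : j₁ ≠ j₃ := by
    rintro rfl
    exact ho.east.not_south hu.south
  rcases hi.lt_or_gt with hlt | hlt
  · have key : ∀ n : ℕ, ∀ l, n = (l - i₁).toNat → i₁ ≤ l → l ≤ j₃ → p.East l → X.Mem p i₁ l := by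
      intro n
      induction n using Nat.strong_induction_on with
      | _ n ih =>
        intro l hn hl hl' hE
        rcases lt_trichotomy l j₁ with hc | rfl | hc
        · exact h₁.mem_of_isQuot ⟨le_rfl, hl, hc.le, fun h => absurd h (lt_irrefl _), fun _ => hE⟩
            (by omega)
        · exact absurd hE hu.south.not_east
        · obtain ⟨k, hk, hk', hEk, hm⟩ := exists_suffix_of_under h₁ hp hu hc (by omega) hE
          rcases hk.eq_or_lt with rfl | hk
          · exact hm
          · exact X.append (ih _ (by omega) (k - 1) rfl (by omega) (by omega) hEk)
              (by simpa using hm)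
    obtain ⟨k, hk, hk', hE, hm⟩ := exists_prefix_of_over h₃ hp ho hlt hlt₁ hu.east
    exact hm (key _ k rfl hk hk' hE)
  rcases hj.lt_or_gt with hlt' | hlt'
  · -- The label above `X` is nested in the label below `X`.
    obtain ⟨k, hk, hk', hE, hm⟩ := exists_suffix_of_under h₁ hp hu hlt' hlt₃' ho.east
    exact h₃.not_mem_of_isSub ⟨by omega, hk', le_rfl, fun _ => hE, fun h => absurd h (lt_irrefl _)⟩
      (by omega) hm
  · have key : ∀ n : ℕ, ∀ l, n = (j₁ - l).toNat → i₃ ≤ l → l ≤ j₁ → p.South (l - 1) →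
        X.Mem p l j₁ := by
      intro n
      induction n using Nat.strong_induction_on with
      | _ n ih =>
        intro l hn hl hl' hS
        rcases lt_trichotomy l i₁ with hc | rfl | hc
        · obtain ⟨k, hk, hk', hSk, hm⟩ := exists_prefix_of_under h₁ hp hu hc (by omega) hS
          rcases hk'.eq_or_lt with rfl | hk'
          · exact hm
          · exact X.append hm (ih _ (by omega) (k + 1) rfl (by omega) (by omega)
              (by simpa using hSk))
        · exact absurd hS hu.east.not_south
        · exact h₁.mem_of_isQuot ⟨hc.le, hl', le_rfl, fun _ => hS, fun h => absurd h (lt_irrefl _)⟩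
            (by omega)
    obtain ⟨k, hk, hk', hS, hm⟩ := exists_suffix_of_over h₃ hp ho hlt' hlt₁' hu.south
    exact hm (key _ k rfl hk hk' hS)

end Middle

/-- A path in the facets of `X` and `Y` lies in the facets of all torsion sets between `X ⊓ Y` and
`X ⊔ Y`. -/
theorem mem_pathSet_of_between {X Y Z : TorsionSet shape} (h₁ : X ⊓ Y ≤ Z) (h₂ : Z ≤ X ⊔ Y)
    {l : List (ℤ × ℤ)} (hX : l ∈ pathSet X) (hY : l ∈ pathSet Y) : l ∈ pathSet Z := by
  obtain ⟨f, a, b, rfl, hpX⟩ := hX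
  have hpY := (seg_mem_pathSet hpX.bent.lt.le).1 hY
  refine ⟨f, a, b, rfl, ⟨hpX.valid.mem, hpX.valid.inner, fun i j k₁ k₂ k₃ hS hE => ?_,
    fun i j k₁ k₂ k₃ hE hS hm => ?_⟩, hpX.left, hpX.right, hpX.bent⟩
  · exact h₁ ⟨hpX.mem ⟨k₁, k₂, k₃, hS, hE⟩, hpY.mem ⟨k₁, k₂, k₃, hS, hE⟩⟩
  · obtain ⟨k, m, hs, hm⟩ := (TorsionSet.mem_sup.1 (h₂ hm)).exists_sub
      fun h => h.elim (fun h => (X.isSeg h).1) fun h => (Y.isSeg h).1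
    have hu : Under f a b i j := ⟨k₁, k₂, k₃, hE, hS⟩
    exact hm.elim ((hpX.free hu).2 _ _ hs) ((hpY.free hu).2 _ _ hs)

theorem facet_eq_pathSet (F : GridTamari shape) : F.1 = pathSet (facetEquiv shape F) :=
  congrArg Subtype.val ((facetEquiv shape).symm_apply_apply F).symm

/-- A flip is a cover of torsion sets labelled by the segment of the flip. The torsion sets between
the meet and the join of the two endpoints all contain the paths common to the endpoints, so the
remaining path is the only one that can be exchanged along covers in this interval. An endpoint
strictly inside the interval, or a torsion set strictly between comparable endpoints, would exchange
the same path along a cover above it and along a cover below it. -/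
theorem isLabel_of_flip {s : Segment shape} {F G : GridTamari shape} (h : GridTamari.Flip s F G) :
    ∃ f i j, s.verts = seg f i j ∧ IsLabel (facetEquiv shape F) (facetEquiv shape G) f i j := by
  obtain ⟨_, _, hFG, hGF, hk⟩ := h
  rw [facet_eq_pathSet F, facet_eq_pathSet G] at hFG hGF
  generalize facetEquiv shape F = X at *
  generalize facetEquiv shape G = Y at *
  have hpX := (Set.eq_singleton_iff_unique_mem.1 hFG).1.1
  have hqY := (Set.eq_singleton_iff_unique_mem.1 hGF).1.1
  obtain ⟨p, a, b, rfl, hp⟩ := hpX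
  obtain ⟨q, c, d, rfl, hq⟩ := hqY
  obtain ⟨i, j, hs, hk⟩ := exists_kiss_of_kissAlong hk
  have hF : X.Free p i j := hp.free ⟨hk.lt₁, hk.le, hk.lt₂, hk.east₁, hk.south₁⟩
  have hm : Y.Mem p i j :=
    Y.congr (hq.mem ⟨hk.lt₃, hk.le, hk.lt₄, hk.south₂, hk.east₂⟩) hk.agree.symm
  have hnle : ¬ Y ≤ X := fun h => hF.not_mem (h hm)
  have hne : ∀ {Z}, X ⊓ Y ≤ Z → Z ≤ X ⊔ Y → ∀ l ∈ pathSet X, l ∉ pathSet Z → l = seg p a b := by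
    intro Z h₁ h₂ l hl hl'
    by_contra hc
    refine hl' (mem_pathSet_of_between h₁ h₂ hl ?_)
    by_contra hY
    exact hc ((Set.ext_iff.1 hFG l).1 ⟨hl, hY⟩)
  have hle : X ≤ Y := by
    by_contra hnle'
    obtain ⟨Z₁, hcov₁, hZ₁⟩ := exists_covBy_le_of_lt
      (show X < X ⊔ Y from lt_of_le_of_ne le_sup_left fun h => hnle (sup_eq_left.1 h.symm))
    obtain ⟨Z₃, hZ₃, hcov₃⟩ := exists_le_covBy_of_lt
      (show X ⊓ Y < X from lt_of_le_of_ne inf_le_left fun h => hnle' (inf_eq_left.1 h))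
    obtain ⟨f₁, i₁, j₁, hl₁⟩ := exists_isLabel hcov₁
    obtain ⟨f₃, i₃, j₃, hl₃⟩ := exists_isLabel hcov₃
    obtain ⟨p₁, a₁, b₁, hp₁, hu, ha₁, he₁⟩ := hl₁.exists_sdiff_eq
    obtain ⟨p₃, a₃, b₃, hp₃, ho, ha₃, he₃⟩ := hl₃.exists_sdiff_eq'
    have hmem₁ := (Set.eq_singleton_iff_unique_mem.1 he₁).1
    have hmem₃ := (Set.eq_singleton_iff_unique_mem.1 he₃).1
    have he := (hne (inf_le_left.trans hcov₁.le) hZ₁ _ hmem₁.1 hmem₁.2).trans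
      (hne hZ₃ (hcov₃.le.trans le_sup_left) _ hmem₃.1 hmem₃.2).symm
    obtain ⟨rfl, rfl, ha⟩ := seg_inj hp₁.bent.lt.le he
    have := hu.lt₁; have := hu.le; have := hu.lt₂
    exact ((hl₁.congr ha₁.symm).congr (ha.mono (by omega) (by omega))).not_under_and_over
      (hl₃.congr ha₃.symm) hp₃ ⟨hu.lt₁, hu.le, hu.lt₂, ha.east hu.east (by omega) (by omega),
        ha.south hu.south (by omega) (by omega)⟩ ho
  obtain ⟨Z, hcov, hZ⟩ := exists_covBy_le_of_lt (lt_of_le_not_ge hle hnle)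
  have hZY : Z = Y := by
    by_contra hne'
    obtain ⟨Z₁, hcov₁, hZ₁⟩ := exists_covBy_le_of_lt (lt_of_le_of_ne hZ hne')
    obtain ⟨f₁, i₁, j₁, hl₁⟩ := exists_isLabel hcov₁
    obtain ⟨f₃, i₃, j₃, hl₃⟩ := exists_isLabel hcov
    obtain ⟨p₁, a₁, b₁, hp₁, hu, ha₁, he₁⟩ := hl₁.exists_sdiff_eq
    obtain ⟨p₃, a₃, b₃, hp₃, ho, ha₃, he₃⟩ := hl₃.exists_sdiff_eq'
    have hmem₁ := (Set.eq_singleton_iff_unique_mem.1 he₁).1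
    have he : seg p₁ a₁ b₁ = seg p₃ a₃ b₃ := by
      refine (Set.ext_iff.1 he₃ _).1 ⟨hmem₁.1, fun hX => hmem₁.2 ?_⟩
      refine mem_pathSet_of_between (inf_le_left.trans (hcov.le.trans hcov₁.le))
        (hZ₁.trans le_sup_right) hX ?_
      -- A path shared by `X` and `Z` differs from `p`, which is lost on the way to `Z`.
      by_contra hY
      obtain ⟨p₂, a₂, b₂, hp₂, -, -, he₂⟩ := hl₃.exists_sdiff_eq
      have hmem₂ := (Set.eq_singleton_iff_unique_mem.1 he₂).1
      have h₁ := (Set.ext_iff.1 hFG _).1 ⟨hX, hY⟩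
      have h₂ := hne (inf_le_left.trans hcov.le) (hZ.trans le_sup_right) _ hmem₂.1 hmem₂.2
      exact hmem₂.2 ((h₁.trans h₂.symm) ▸ hmem₁.1)
    obtain ⟨rfl, rfl, ha⟩ := seg_inj hp₁.bent.lt.le he
    have := hu.lt₁; have := hu.le; have := hu.lt₂
    exact ((hl₁.congr ha₁.symm).congr (ha.mono (by omega) (by omega))).not_under_and_over
      (hl₃.congr ha₃.symm) hp₃ ⟨hu.lt₁, hu.le, hu.lt₂, ha.east hu.east (by omega) (by omega),
        ha.south hu.south (by omega) (by omega)⟩ ho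
  subst hZY
  obtain ⟨f, k, l, hl⟩ := exists_isLabel hcov
  obtain ⟨rfl, rfl, ha⟩ := hl.unique hm hF
  exact ⟨p, i, j, hs, hl.congr ha⟩

/-! ### Congruences of a lattice labelled by join-irreducibles -/

/-- A finite lattice `L` represented by sets of elements of a poset `S`, in such a way that every
`s : S` has a smallest element `principal s` containing it and a largest element `principalStar s`
properly below `principal s`. The last two fields control the congruences: a congruence contracting
`s` is forced to contract everything above `s`, and restricting the sets to any lower set of `S` is
compatible with joins. -/
structure Labelling (L S : Type*) [Lattice L] [PartialOrder S] where
  /-- The set represented by an element of the lattice. -/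
  mem : L → Set S
  subset_iff : ∀ {x y}, mem x ⊆ mem y ↔ x ≤ y
  /-- The smallest element containing `s`. -/
  principal : S → L
  principal_le_iff : ∀ {s x}, principal s ≤ x ↔ s ∈ mem x
  /-- The largest element properly below `principal s`. -/
  principalStar : S → L
  mem_principalStar : ∀ {s t}, t ∈ mem (principalStar s) ↔ t ∈ mem (principal s) ∧ t ≠ s
  /-- A rank for which the elements of `principalStar s` come before `s`. -/
  rank : S → ℕ
  rank_lt : ∀ {s t}, t ∈ mem (principalStar s) → rank t < rank s
  forcing : ∀ {s t}, s ≤ t →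
    ∃ z, principalStar s ≤ z ∧ t ∉ mem z ∧ t ∈ mem (principal s ⊔ z)
  sup_restrict : ∀ {V : Set S}, IsLowerSet V → ∀ {x x' y y'}, (∀ s ∈ V, s ∈ mem x → s ∈ mem x') →
    (∀ s ∈ V, s ∈ mem y → s ∈ mem y') → ∀ s ∈ V, s ∈ mem (x ⊔ y) → s ∈ mem (x' ⊔ y')

namespace Labelling

variable {L S : Type*} [Lattice L] [PartialOrder S] (e : Labelling L S)

theorem mem_inf {x y : L} {s : S} : s ∈ e.mem (x ⊓ y) ↔ s ∈ e.mem x ∧ s ∈ e.mem y := by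
  simp only [← e.principal_le_iff, le_inf_iff]

theorem principalStar_le (s : S) : e.principalStar s ≤ e.principal s :=
  e.subset_iff.1 fun _ h => (e.mem_principalStar.1 h).1

theorem le_principalStar {s : S} {x : L} (h : x ≤ e.principal s) (hs : s ∉ e.mem x) :
    x ≤ e.principalStar s :=
  e.subset_iff.1 fun _ ht => e.mem_principalStar.2
    ⟨e.subset_iff.2 h ht, fun hts => hs (hts ▸ ht)⟩

/-- The elements of `S` whose cover `principalStar s ⋖ principal s` is contracted. -/
def contracted (c : LatticeCon L) : Set S := {s | c.r (e.principalStar s) (e.principal s)}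

theorem mem_contracted_of_rel {c : LatticeCon L} {x y : L} (h : c.r x y) {s : S}
    (hx : s ∉ e.mem x) (hy : s ∈ e.mem y) : s ∈ e.contracted c := by
  have h₁ := c.inf (c.refl (e.principal s)) h
  rw [inf_eq_left.2 (e.principal_le_iff.2 hy)] at h₁
  have h₂ := c.sup (c.refl (e.principalStar s)) h₁
  rwa [sup_eq_left.2 (e.le_principalStar inf_le_left fun hs => hx (e.mem_inf.1 hs).2),
    sup_eq_right.2 (e.principalStar_le s)] at h₂

theorem isUpperSet_contracted (c : LatticeCon L) : IsUpperSet (e.contracted c) := by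
  intro s t hst hs
  obtain ⟨z, hz, ht, ht'⟩ := e.forcing hst
  have h := c.sup (show c.r (e.principalStar s) (e.principal s) from hs) (c.refl z)
  rw [sup_eq_right.2 hz] at h
  exact e.mem_contracted_of_rel h ht ht'

theorem rel_of_le [Finite L] {c : LatticeCon L} {x y : L} (hxy : x ≤ y)
    (h : ∀ s ∈ e.mem y, s ∉ e.mem x → s ∈ e.contracted c) : c.r x y := by
  obtain ⟨z, hz⟩ := (Set.toFinite {z | x ≤ z ∧ z ≤ y ∧ c.r x z}).exists_maximal
    ⟨x, le_rfl, hxy, c.refl x⟩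
  obtain ⟨hxz, hzy, hc⟩ := hz.1
  suffices z = y from this ▸ hc
  by_contra hne
  have hex : ∃ n, ∃ s, s ∈ e.mem y ∧ s ∉ e.mem z ∧ e.rank s = n := by
    have : ¬ e.mem y ⊆ e.mem z := fun hs => hne (le_antisymm hzy (e.subset_iff.1 hs))
    obtain ⟨s, hs, hs'⟩ := Set.not_subset.1 this
    exact ⟨_, s, hs, hs', rfl⟩
  classical
  obtain ⟨s, hsy, hsz, hn⟩ := Nat.find_spec hex
  have hle : e.principalStar s ≤ z := by
    refine e.subset_iff.1 fun t ht => ?_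
    by_contra htz
    exact Nat.find_min hex (hn ▸ e.rank_lt ht)
      ⟨t, e.subset_iff.2 (e.principal_le_iff.2 hsy) (e.mem_principalStar.1 ht).1, htz, rfl⟩
  have hcs : c.r (e.principalStar s) (e.principal s) :=
    h s hsy fun hx => hsz (e.subset_iff.2 hxz hx)
  have hc' := c.sup (c.refl z) hcs
  rw [sup_eq_left.2 hle] at hc'
  exact hsz (e.principal_le_iff.1 (le_sup_right.trans (hz.2
    ⟨hxz.trans le_sup_left, sup_le hzy (e.principal_le_iff.2 hsy), c.trans hc hc'⟩ le_sup_left)))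

/-- A congruence is determined by the set of elements that it contracts. -/
theorem rel_iff [Finite L] {c : LatticeCon L} {x y : L} :
    c.r x y ↔ ∀ s ∉ e.contracted c, (s ∈ e.mem x ↔ s ∈ e.mem y) := by
  constructor
  · refine fun h s hs => ⟨fun hx => ?_, fun hy => ?_⟩
    · exact by_contra fun hy => hs (e.mem_contracted_of_rel (c.symm h) hy hx)
    · exact by_contra fun hx => hs (e.mem_contracted_of_rel h hx hy)
  · intro h
    have aux : ∀ {x y : L}, (∀ s ∉ e.contracted c, (s ∈ e.mem x ↔ s ∈ e.mem y)) →
        c.r x (x ⊔ y) := by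
      intro x y h
      refine e.rel_of_le le_sup_left fun s hs hx => by_contra fun hc => hx ?_
      have := e.sup_restrict (e.isUpperSet_contracted c).compl (x := x) (x' := x) (y := y)
        (y' := x) (fun _ _ h => h) (fun t ht hy => (h t ht).2 hy) s hc hs
      rwa [sup_idem] at this
    have h₂ := aux fun s hs => (h s hs).symm
    rw [sup_comm] at h₂
    exact c.trans (aux h) (c.symm h₂)

/-- The congruence contracting a given upper set. -/
def conOf (U : Set S) (hU : IsUpperSet U) : LatticeCon L where
  r x y := ∀ s ∉ U, (s ∈ e.mem x ↔ s ∈ e.mem y)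
  iseqv := ⟨fun _ _ _ => Iff.rfl, fun h s hs => (h s hs).symm,
    fun h h' s hs => (h s hs).trans (h' s hs)⟩
  inf h h' s hs := by rw [e.mem_inf, e.mem_inf, h s hs, h' s hs]
  sup h h' s hs :=
    ⟨e.sup_restrict hU.compl (fun t ht => (h t ht).1) (fun t ht => (h' t ht).1) s hs,
      e.sup_restrict hU.compl (fun t ht => (h t ht).2) (fun t ht => (h' t ht).2) s hs⟩

theorem contracted_conOf (U : Set S) (hU : IsUpperSet U) : e.contracted (e.conOf U hU) = U := by
  ext s
  constructor
  · intro h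
    by_contra hs
    exact (e.mem_principalStar.1 ((h s hs).2 (e.principal_le_iff.1 le_rfl))).2 rfl
  · intro hs t ht
    rw [e.mem_principalStar]
    exact ⟨fun h => h.1, fun h => ⟨h, fun hts => ht (hts ▸ hs)⟩⟩

/-- Congruences correspond to the lower sets of the dual of `S`. -/
def conEquiv [Finite L] : LatticeCon L ≃o LowerSet Sᵒᵈ where
  toFun c := ⟨OrderDual.ofDual ⁻¹' e.contracted c, fun _ _ h hs => e.isUpperSet_contracted c h hs⟩
  invFun V := e.conOf (OrderDual.toDual ⁻¹' (V : Set Sᵒᵈ)) fun _ _ h hs => V.lower h hs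
  left_inv c := le_antisymm (fun _ _ h => e.rel_iff.2 h) fun _ _ h => e.rel_iff.1 h
  right_inv V := SetLike.coe_injective <|
    congrArg (OrderDual.ofDual ⁻¹' ·) (e.contracted_conOf _ fun _ _ h hs => V.lower h hs)
  map_rel_iff' {c d} := by
    constructor
    · intro h x y hc
      exact e.rel_iff.2 fun s hs => e.rel_iff.1 hc s fun hs' => hs (h (a := OrderDual.toDual s) hs')
    · exact fun h s hs => h hs

theorem mem_conEquiv [Finite L] {c : LatticeCon L} {s : S} :
    OrderDual.toDual s ∈ e.conEquiv c ↔ s ∈ e.contracted c := Iff.rfl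

/-- If `s` is the smallest element of `S` that distinguishes `x ≤ y`, then the congruence generated
by `x` and `y` is the one that contracts precisely the elements above `s`. -/
theorem conEquiv_symm_Iic [Finite L] {x y : L} {s : S} (hxy : x ≤ y) (hx : s ∉ e.mem x)
    (hy : s ∈ e.mem y) (hs : ∀ t ∈ e.mem y, t ∉ e.mem x → s ≤ t) :
    e.conEquiv.symm (LowerSet.Iic (OrderDual.toDual s)) = LatticeCon.con x y := by
  apply le_antisymm
  · refine le_sInf fun c hc => ?_
    rw [OrderIso.symm_apply_le, LowerSet.Iic_le, e.mem_conEquiv]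
    exact e.mem_contracted_of_rel hc hx hy
  · refine sInf_le ?_
    intro t ht
    exact ⟨fun h => e.subset_iff.2 hxy h, fun h => by_contra fun h' => ht (hs t h h')⟩

/-- Transport of a labelling along an order isomorphism. -/
def comap {L' : Type*} [Lattice L'] (φ : L' ≃o L) : Labelling L' S where
  mem x := e.mem (φ x)
  subset_iff := e.subset_iff.trans φ.le_iff_le
  principal s := φ.symm (e.principal s)
  principal_le_iff := φ.symm_apply_le.trans e.principal_le_iff
  principalStar s := φ.symm (e.principalStar s)
  mem_principalStar {s t} := by simpa using e.mem_principalStar (s := s) (t := t)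
  rank := e.rank
  rank_lt h := e.rank_lt (by simpa using h)
  forcing h := by
    obtain ⟨z, h₁, h₂, h₃⟩ := e.forcing h
    exact ⟨φ.symm z, φ.symm.monotone h₁, by simpa using h₂, by simpa using h₃⟩
  sup_restrict hV _ _ _ _ hx hy s hs h := by
    rw [φ.map_sup] at h ⊢
    exact e.sup_restrict hV hx hy s hs h

end Labelling

theorem map_supIrred {α β : Type*} [SemilatticeSup α] [SemilatticeSup β]
    (e : α ≃o β) {a : α} (h : SupIrred a) : SupIrred (e a) := by
  refine ⟨fun hmin => h.1 fun b hb => ?_, fun b c hbc => ?_⟩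
  · simpa using hmin (e.monotone hb)
  · have := h.2 (show e.symm b ⊔ e.symm c = a by rw [← e.symm.map_sup, hbc]; simp)
    rwa [e.symm_apply_eq, e.symm_apply_eq] at this

theorem supIrred_apply_iff {α β : Type*} [SemilatticeSup α] [SemilatticeSup β] (e : α ≃o β)
    {a : α} : SupIrred (e a) ↔ SupIrred a :=
  ⟨fun h => by simpa using map_supIrred e.symm h, fun h => map_supIrred e h⟩

/-- The join-irreducible elements of a lattice of lower sets are the principal lower sets. -/
noncomputable def supIrredEquiv {α β : Type*} [PartialOrder α] [Finite α] [SemilatticeSup β]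
    (e : β ≃o LowerSet α) : α ≃o {c : β // SupIrred c} :=
  OrderIso.supIrredLowerSet.trans
    { toEquiv := e.symm.toEquiv.subtypeEquiv fun _ => (supIrred_apply_iff e.symm).symm
      map_rel_iff' := e.symm.map_rel_iff }

theorem supIrredEquiv_apply {α β : Type*} [PartialOrder α] [Finite α] [SemilatticeSup β]
    (e : β ≃o LowerSet α) (a : α) : (supIrredEquiv e a).1 = e.symm (LowerSet.Iic a) := rfl

/-! ### The Grid-Tamari lattice -/

/-- Facets are ordered by inclusion of their torsion sets. -/
noncomputable abbrev gridTamariLattice (shape : Finset (ℤ × ℤ)) : Lattice (GridTamari shape) where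
  le F G := facetEquiv shape F ≤ facetEquiv shape G
  le_refl F := le_refl (facetEquiv shape F)
  le_trans F G H h h' := le_trans (α := TorsionSet shape) h h'
  le_antisymm F G h h' := (facetEquiv shape).injective (le_antisymm h h')
  sup F G := (facetEquiv shape).symm (facetEquiv shape F ⊔ facetEquiv shape G)
  inf F G := (facetEquiv shape).symm (facetEquiv shape F ⊓ facetEquiv shape G)
  le_sup_left F G := by rw [Equiv.apply_symm_apply]; exact le_sup_left
  le_sup_right F G := by rw [Equiv.apply_symm_apply]; exact le_sup_right
  sup_le F G H h h' := by rw [Equiv.apply_symm_apply]; exact sup_le h h'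
  inf_le_left F G := by rw [Equiv.apply_symm_apply]; exact inf_le_left
  inf_le_right F G := by rw [Equiv.apply_symm_apply]; exact inf_le_right
  le_inf F G H h h' := by rw [Equiv.apply_symm_apply]; exact le_inf h h'

/-- Inclusion of torsion sets is reachability by flips. -/
theorem le_iff_reach {F G : GridTamari shape} :
    facetEquiv shape F ≤ facetEquiv shape G ↔ GridTamari.Reach F G := by
  constructor
  · intro h
    generalize hX : facetEquiv shape F = X at h
    induction X using WellFoundedGT.induction generalizing F with
    | ind X ih =>
      subst hX
      rcases h.eq_or_lt with he | hlt
      · rw [(facetEquiv shape).injective he]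
        exact Relation.ReflTransGen.refl
      · obtain ⟨Z, hcov, hZ⟩ := exists_covBy_le_of_lt hlt
        obtain ⟨f, i, j, hl⟩ := exists_isLabel hcov
        have hflip := hl.flip (s := hl.free.1.toSegment) rfl
        rw [Equiv.symm_apply_apply] at hflip
        exact Relation.ReflTransGen.head ⟨_, hflip⟩
          (ih Z hcov.lt (Equiv.apply_symm_apply _ _) hZ)
  · intro h
    induction h with
    | refl => exact le_rfl
    | tail _ h ih =>
      obtain ⟨s, hs⟩ := h
      obtain ⟨f, i, j, -, hl⟩ := isLabel_of_flip hs
      exact ih.trans hl.le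

/-! ### The labelling by segments and the congruences -/

namespace SegmentWalk

/-- A walk tracing the segment. -/
noncomputable def walk (s : Segment shape) : Walk := (exists_isSeg_eq_seg s).choose

/-- The diagonal of the first vertex of the segment. -/
noncomputable def first (s : Segment shape) : ℤ := (exists_isSeg_eq_seg s).choose_spec.choose

/-- The diagonal of the last vertex of the segment. -/
noncomputable def last (s : Segment shape) : ℤ :=
  (exists_isSeg_eq_seg s).choose_spec.choose_spec.choose

theorem isSeg (s : Segment shape) : IsSeg shape (walk s) (first s) (last s) :=
  (exists_isSeg_eq_seg s).choose_spec.choose_spec.choose_spec.1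

theorem verts_eq (s : Segment shape) : s.verts = seg (walk s) (first s) (last s) :=
  (exists_isSeg_eq_seg s).choose_spec.choose_spec.choose_spec.2

theorem toSegment_isSeg (s : Segment shape) : (isSeg s).toSegment = s := 
    (Segment.ext (verts_eq s)).symm

end SegmentWalk

open SegmentWalk

/-- The torsion sets of the shape, as sets of segments, form a labelled lattice. -/
noncomputable def torsionLabelling (shape : Finset (ℤ × ℤ)) :
    Labelling (TorsionSet shape) (Segment shape) where
  mem := TorsionSet.segments
  subset_iff := TorsionSet.segments_subset_iff
  principal s := TorsionSet.principal _ _ _ (isSeg s)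
  principal_le_iff {s X} := by
    rw [TorsionSet.principal_le_iff, TorsionSet.mem_segments_iff (isSeg s) (verts_eq s)]
  principalStar s := TorsionSet.principalStar _ _ _ (isSeg s)
  mem_principalStar {s t} := by
    rw [TorsionSet.mem_segments_iff (isSeg t) (verts_eq t),
      TorsionSet.mem_segments_iff (isSeg t) (verts_eq t)]
    refine and_congr_right fun h => not_congr ⟨fun h' => Segment.ext ?_, ?_⟩
    · have ha := h.2
      rw [verts_eq t, verts_eq s]
      rw [h'.1, h'.2] at ha ⊢
      exact ha.symm.seg
    · rintro rfl
      exact ⟨rfl, rfl⟩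
  rank s := s.verts.length
  rank_lt {s t} h := by
    rw [TorsionSet.mem_segments_iff (isSeg t) (verts_eq t)] at h
    obtain ⟨⟨hq, -⟩, hne⟩ := h
    have := hq.left; have := hq.le; have := hq.right
    rw [verts_eq t, verts_eq s, length_seg, length_seg]
    omega
  forcing {s t} h := by
    have ht := isSeg t
    obtain ⟨i, j, h₁, h₂, h₃, hs⟩ :=
      (infix_seg_iff s.ne_nil).1 (verts_eq t ▸ h : s.verts <:+: seg (walk t) (first t) (last t))
    have hs' := ht.mono h₁ h₂ h₃
    obtain ⟨hp, hp'⟩ := TorsionSet.principal_eq_of_seg_eq (isSeg s) hs' (verts_eq s ▸ hs)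
    refine ⟨TorsionSet.avoiding _ _ _ i j ht, ?_, ?_, ?_⟩
    · rw [hp']
      exact TorsionSet.principalStar_le_avoiding ht h₁ h₃ hs'
    · rw [TorsionSet.mem_segments_iff ht (verts_eq t)]
      exact TorsionSet.not_mem_avoiding ht h₁ h₃
    · rw [hp, TorsionSet.mem_segments_iff ht (verts_eq t)]
      exact TorsionSet.mem_principal_sup_avoiding ht h₁ h₃ hs'
  sup_restrict {V} hV {X X' Y Y'} hX hY s hs h := by
    rw [TorsionSet.mem_segments_iff (isSeg s) (verts_eq s)] at h ⊢
    refine TorsionSet.mem_sup_of_restrict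
      (V := fun f i j => ∃ h : IsSeg shape f i j, h.toSegment ∈ V) ?_ ?_ ?_ ⟨isSeg s, ?_⟩ h
    · rintro f i j i' j' ⟨hf, hv⟩ h₁ h₂ h₃
      exact ⟨hf.mono h₁ h₂ h₃,
        hV ((seg_infix_seg_iff h₂).2 ⟨h₁, h₃, Walk.Agree.refl _ _ _⟩) hv⟩
    · rintro f i j ⟨hf, hv⟩ hm
      exact (TorsionSet.toSegment_mem_segments hf).1
        (hX _ hv ((TorsionSet.toSegment_mem_segments hf).2 hm))
    · rintro f i j ⟨hf, hv⟩ hm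
      exact (TorsionSet.toSegment_mem_segments hf).1
        (hY _ hv ((TorsionSet.toSegment_mem_segments hf).2 hm))
    · rwa [toSegment_isSeg]

end NonKissing

open NonKissing

theorem theorem1p2 (shape : Finset (ℤ × ℤ)) :
    ∃ _ : Lattice (GridTamari shape),
      (∀ F G : GridTamari shape, F ≤ G ↔ GridTamari.Reach F G) ∧
      (∃ Φ : (Segment shape)ᵒᵈ ≃o {c : LatticeCon (GridTamari shape) // SupIrred c},
        ∀ (s : Segment shape) (F G : GridTamari shape),
          GridTamari.Flip s F G → (Φ (OrderDual.toDual s)).1 = LatticeCon.con F G) ∧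
      Nonempty (LatticeCon (GridTamari shape) ≃o LowerSet (Segment shape)ᵒᵈ) := by
  let _ := gridTamariLattice shape
  let φ : GridTamari shape ≃o TorsionSet shape := ⟨facetEquiv shape, Iff.rfl⟩
  have : Finite (GridTamari shape) := Finite.of_equiv _ (facetEquiv shape).symm
  let e := (torsionLabelling shape).comap φ
  refine ⟨inferInstance, fun F G => le_iff_reach, ⟨supIrredEquiv e.conEquiv, ?_⟩, ⟨e.conEquiv⟩⟩
  intro s F G h
  obtain ⟨f, i, j, hs, hl⟩ := isLabel_of_flip h
  rw [supIrredEquiv_apply]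
  refine e.conEquiv_symm_Iic hl.le ?_ ?_ ?_
  · exact fun hm => hl.free.not_mem ((TorsionSet.mem_segments_iff hl.free.1 hs).1 hm)
  · exact (TorsionSet.mem_segments_iff hl.free.1 hs).2 hl.mem
  · -- A segment gained along the flip has a torsion-free quotient piece, which must be the label.
    rintro t ⟨g, k, l, ht, hm⟩ hF
    have hg := TorsionSet.isSeg _ hm
    obtain ⟨k', l', hq, hfree⟩ := TorsionSet.exists_free_quot hg
      fun h => hF ((TorsionSet.mem_segments_iff hg ht).2 h)
    obtain ⟨rfl, rfl, ha⟩ := hl.unique (TorsionSet.quot _ hm hq) hfree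
    change s.verts <:+: t.verts
    rw [hs, ht, seg_infix_seg_iff hq.le]
    exact ⟨hq.left, hq.right, ha⟩
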